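/- Let $$L=\Big\{\,l(\alpha) : \alpha\in\mathbb R\setminus\mathbb Q,\ l(\alpha)<\infty\Big\},\qquad l(\alpha)=\limsup_{\substack{|p|,|q|\to\infty\\ p,q\in\mathbb Z}}\frac1{|q(q\alpha-p)|},$$ be the Lagrange spectrum, and let the Markov spectrum $M$ be the set of the finite values of $$\frac{\sqrt{b^2-4ac}}{\inf_{(x,y)\in\mathbb Z^2\setminus\{(0,0)\}}|ax^2+bxy+cy^2|},$$ where $ax^2+bxy+cy^2$ runs over the real binary quadratic forms with $b^2-4ac>0$. For a sequence $S=(a_n)_{n\in\mathbb Z}$ of positive integers put $$\lambda_0(S)=[a_0,a_1,a_2,\dots]+[0,a_{-1},a_{-2},\dots],$$ the sum of the values of the two continued fractions. Let $w=2212112$ and $w^*=2212^*112$, where the asterisk marks the letter at index $0$ of a bi-infinite sequence, and an overline on a finite word stands for its infinite repetition (to the left when it is the leftmost word of the sequence, to the right when it is the rightmost, in both directions when it is the only one). Put $$b_\infty=\lambda_0(\overline{2212^*112}),\qquad B_\infty=\lambda_0(\overline{211211212221}\,w\,w\,w^*\,w\,\overline{112122212112}),\qquad m_1=\lambda_0(\overline{221211}\,w\,w^*\,\overline{w}),$$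 $$\delta_0=\frac{272052036746460995-3973474319367040\sqrt{87}-2762049221999040\sqrt{18229}+353887557067187\sqrt{151905}}{226488036203921280}.$$ Theorem. The Hausdorff distance between $M$ and $L$ satisfies $d_H(M,L)\ge\delta_0$, and $|\delta_0-9.1094243388\times10^{-8}|<10^{-18}$. Moreover, $b_\infty<B_\infty$, $|b_\infty-3.2930442439|<10^{-10}$, and $(b_\infty,B_\infty)$ is a gap of $L$: it contains no point of $L$, while $b_\infty\in L$ and $B_\infty\in L$. The point $m_1$ belongs to $M$ and to $(b_\infty,B_\infty)$, and its distance to $L$ is $$\inf_{\ell\in L}|m_1-\ell|=B_\infty-m_1=\delta_0 .$$ -/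

import Mathlib

open Filter Topology

noncomputable section

namespace MarkovLagrange

/-- `l(α) = limsup 1 / |q (q α - p)|` over pairs of integers `(p, q)` with `|p|, |q| → ∞`,
as an extended real number. -/
def bestConstant (α : ℝ) : EReal :=
  limsup (fun v : ℤ × ℤ => ((1 / |(v.2 : ℝ) * ((v.2 : ℝ) * α - (v.1 : ℝ))| : ℝ) : EReal))
    ((cofinite : Filter ℤ) ×ˢ (cofinite : Filter ℤ))

/-- The Lagrange spectrum: the finite values `l(α)`, for `α` irrational. -/
def lagrangeSpectrum : Set ℝ :=
  {x : ℝ | ∃ α : ℝ, Irrational α ∧ bestConstant α = (x : EReal)}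

/-- The infimum of `|a x² + b x y + c y²|` over the integer points `(x, y) ≠ (0, 0)`. -/
def formInf (a b c : ℝ) : ℝ :=
  ⨅ v : {v : ℤ × ℤ // v ≠ (0, 0)},
    |a * (v.1.1 : ℝ) ^ 2 + b * (v.1.1 : ℝ) * (v.1.2 : ℝ) + c * (v.1.2 : ℝ) ^ 2|

/-- The Markov spectrum: the finite values of `√Δ(q) / inf |q|`, for `q` a real indefinite binary
quadratic form. The quotient is finite exactly when the infimum is positive. -/
def markovSpectrum : Set ℝ :=
  {x : ℝ | ∃ a b c : ℝ, 0 < b ^ 2 - 4 * a * c ∧ 0 < formInf a b c ∧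
    x = Real.sqrt (b ^ 2 - 4 * a * c) / formInf a b c}

/-- The infinite continued fraction `a 0 + 1 / (a 1 + 1 / (a 2 + ⋯))`. -/
def contFrac (a : ℕ → ℕ) : GenContFract ℝ where
  h := (a 0 : ℝ)
  s := Stream'.Seq.ofStream fun n : ℕ => ⟨1, (a (n + 1) : ℝ)⟩

/-- The value `[a 0, a 1, a 2, …]`: the limit of the convergents (which exists as soon as
`a n` is positive for all `n ≥ 1`). -/
def cfValue (a : ℕ → ℕ) : ℝ :=
  limUnder atTop (contFrac a).convs

/-- `λ₀(S) = [S₀, S₁, S₂, …] + [0, S₋₁, S₋₂, …]`. -/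
def lambdaZero (S : ℤ → ℕ) : ℝ :=
  cfValue (fun n : ℕ => S (n : ℤ)) +
    cfValue (fun n : ℕ => if n = 0 then 0 else S (-(n : ℤ)))

/-- The bi-infinite sequence `… u u u v r r r …`, where the letter number `k` (counted from `0`)
of the finite word `v` stands at index `0`. -/
def biSeq (u v r : List ℕ) (k : ℕ) : ℤ → ℕ := fun n =>
  if n + k < 0 then u.getD ((n + k) % (u.length : ℤ)).toNat 0
  else if n + k < v.length then v.getD (n + k).toNat 0
  else r.getD ((n + k - v.length) % (r.length : ℤ)).toNat 0

/-- The word `w = 2212112`. -/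
def w : List ℕ := [2, 2, 1, 2, 1, 1, 2]

/-- `b_∞ = λ₀(⋯ w w w* w w ⋯)`, with `w* = 2212*112`. -/
def bInf : ℝ := lambdaZero (biSeq w w w 3)

/-- `B_∞ = λ₀(⋯ u u  w w w* w  r r ⋯)`, with `w* = 2212*112`, `u = 211211212221` and
`r = 112122212112`. -/
def BInf : ℝ :=
  lambdaZero (biSeq [2, 1, 1, 2, 1, 1, 2, 1, 2, 2, 2, 1] (w ++ w ++ w ++ w)
    [1, 1, 2, 1, 2, 2, 2, 1, 2, 1, 1, 2] 17)

/-- `m₁ = λ₀(⋯ u u  w w*  w w ⋯)`, with `w* = 2212*112` and `u = 221211`. -/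
def mOne : ℝ := lambdaZero (biSeq [2, 2, 1, 2, 1, 1] (w ++ w) w 10)

/-- The explicit constant `δ₀`. -/
def deltaZero : ℝ :=
  (272052036746460995 - 3973474319367040 * Real.sqrt 87 - 2762049221999040 * Real.sqrt 18229
    + 353887557067187 * Real.sqrt 151905) / 226488036203921280

end MarkovLagrange

end

/-! By Legendre's theorem, every very good rational approximation is a convergent. Hence the
approximation constant of α = [a, S₁, S₂, …] is governed by the values `lam S n` as n → +∞
(`le_bestConstant`, `bestConstant_le`), while a bi-infinite sequence on which `lam` is maximal at
the origin, with value at least 3, gives a point of M (`lam_mem_markovSpectrum`). A Lagrange value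
must recur arbitrarily far to the right; a Markov value may be attained only once. The problem
becomes one about sequences of 1 and 2.

The gap rests on three facts about sequences with `lam` everywhere below a threshold just above B∞
(`Adm`). Local uniqueness (`Adm.reads_w3`): around any value of `lam` above a number just below b∞
one reads www, forwards or backwards. Self-replication (`Adm.replicate`): www is followed by another
w, except where wwww is followed by 1. Minimality (`Adm.BInf_le`): at such an exception `lam` takes
a value at least B∞. The first two are finite tree searches; the third compares with the sequence of
B∞ at the first differing letter.

Suppose x ∈ L and b∞ < x < B∞, realized by S (`gap`). Limits of shifts of S satisfy `lam` ≤ x, so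
they are admissible and by minimality have no exception; by compactness, replication never fails far
out in S. Local uniqueness provides www, in one direction, in S as far out as desired, so S is
eventually periodic of period w or its reversal. Then the limsup is at most b∞, a contradiction.

The value B∞ is in L because the two periodic ends of its sequence are the same periodic word:
copies of its centre can be chained with longer and longer periodic stretches between them
(`BInf_mem`). The two ends of the sequence of m₁ have different periods, but its maximum at the
origin is enough for M (`mOne_mem`). Since m₁ lies nearer to B∞ than to b∞, its distance to L is B∞
− m₁, which is computed from the quadratic irrationals giving the periodic ends. -/

noncomputable section

namespace MarkovLagrange

/-! ### Continued fractions of sequences of positive integers -/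

/-- The sequence `a` with its first letter removed. -/
def shift (a : ℕ → ℕ) : ℕ → ℕ := fun n => a (n + 1)

/-- The finite continued fraction `[a 0, …, a n]`. -/
def finCF : (ℕ → ℕ) → ℕ → ℝ
  | a, 0 => a 0
  | a, n + 1 => a 0 + 1 / finCF (shift a) n

lemma convs'Aux_contFrac (a : ℕ → ℕ) (n : ℕ) :
    GenContFract.convs'Aux (contFrac a).s (n + 1) = 1 / finCF (shift a) n := by
  induction n generalizing a with
  | zero =>
    rw [GenContFract.convs'Aux_succ_some (p := ⟨1, (a 1 : ℝ)⟩) rfl]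
    simp [finCF, shift, GenContFract.convs'Aux]
  | succ n ih =>
    rw [GenContFract.convs'Aux_succ_some (p := ⟨1, (a 1 : ℝ)⟩) rfl]
    have : (contFrac a).s.tail = (contFrac (shift a)).s := rfl
    rw [this, ih]
    simp [finCF, shift]

lemma convs'_contFrac (a : ℕ → ℕ) (n : ℕ) : (contFrac a).convs' n = finCF a n := by
  cases n with
  | zero => simp [GenContFract.convs', finCF, contFrac, GenContFract.convs'Aux]
  | succ n =>
    rw [GenContFract.convs', convs'Aux_contFrac]
    rfl

lemma convs_contFrac {a : ℕ → ℕ} (ha : ∀ n, 0 < a (n + 1)) (n : ℕ) :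
    (contFrac a).convs n = finCF a n := by
  rw [← convs'_contFrac]
  apply GenContFract.convs_eq_convs'
  intro gp m _ h
  have h' : (⟨1, (a (m + 1) : ℝ)⟩ : GenContFract.Pair ℝ) = gp := Option.some.inj h
  subst h'
  exact ⟨one_pos, Nat.cast_pos.2 (ha m)⟩

lemma le_finCF {a : ℕ → ℕ} (ha : ∀ n, 0 < a (n + 1)) (n : ℕ) :
    (a 0 : ℝ) ≤ finCF a n ∧ finCF a n ≤ a 0 + 1 := by
  induction n generalizing a with
  | zero => simp [finCF]
  | succ n ih =>
    obtain ⟨h1, -⟩ := ih (a := shift a) fun n => ha (n + 1)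
    have h2 : (1 : ℝ) ≤ (shift a) 0 := by exact_mod_cast ha 0
    have h3 : (1 : ℝ) ≤ finCF (shift a) n := h2.trans h1
    have h4 : 1 / finCF (shift a) n ≤ 1 := by
      rw [div_le_one (by linarith)]; exact h3
    have h5 : 0 < 1 / finCF (shift a) n := by positivity
    constructor <;> simp only [finCF] <;> linarith

/-- Two continued fraction steps contract by a factor 4, because (b x + 1)(b y + 1) ≥ 4. This gives
both the convergence of `finCF` and the uniqueness of expansions. -/
lemma abs_two_step (b x y : ℝ) (hb : 1 ≤ b) (hx : 1 ≤ x) (hy : 1 ≤ y) :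
    |1 / (b + 1 / x) - 1 / (b + 1 / y)| ≤ |x - y| / 4 := by
  have hx0 : 0 < x := by linarith
  have hy0 : 0 < y := by linarith
  have hb0 : 0 < b := by linarith
  have h1 : 2 ≤ b * x + 1 := by nlinarith
  have h2 : 2 ≤ b * y + 1 := by nlinarith
  have : 1 / (b + 1 / x) - 1 / (b + 1 / y) = (x - y) / ((b * x + 1) * (b * y + 1)) := by
    field_simp
    ring
  rw [this, abs_div, abs_of_pos (a := (b * x + 1) * (b * y + 1)) (by positivity)]
  exact div_le_div_of_nonneg_left (abs_nonneg _) (by norm_num) (by nlinarith)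

lemma abs_finCF_sub_le {a b : ℕ → ℕ} (ha : ∀ n, 0 < a (n + 1)) (hb : ∀ n, 0 < b (n + 1)) (k : ℕ)
    (hab : ∀ i ≤ 2 * k, a i = b i) (n m : ℕ) :
    |finCF a (n + 2 * k) - finCF b (m + 2 * k)| ≤ (1 / 4) ^ k := by
  induction k generalizing a b with
  | zero =>
    obtain ⟨h1, h2⟩ := le_finCF ha n
    obtain ⟨h3, h4⟩ := le_finCF hb m
    have : a 0 = b 0 := hab 0 le_rfl
    rw [this] at h1 h2
    simp only [mul_zero, add_zero, pow_zero]
    rw [abs_le]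
    constructor <;> linarith
  | succ k ih =>
    have e0 : a 0 = b 0 := hab 0 (by omega)
    have e1 : a 1 = b 1 := hab 1 (by omega)
    have h := ih (a := shift (shift a)) (b := shift (shift b)) (fun n => ha (n + 2))
      (fun n => hb (n + 2)) (fun i hi => hab (i + 2) (by omega))
    have ea : ∀ n, finCF a (n + 2 * (k + 1)) =
        a 0 + 1 / (a 1 + 1 / finCF (shift (shift a)) (n + 2 * k)) := fun n => by
      rw [show n + 2 * (k + 1) = (n + 2 * k) + 1 + 1 by ring]; rfl
    have eb : ∀ n, finCF b (n + 2 * (k + 1)) =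
        b 0 + 1 / (b 1 + 1 / finCF (shift (shift b)) (n + 2 * k)) := fun n => by
      rw [show n + 2 * (k + 1) = (n + 2 * k) + 1 + 1 by ring]; rfl
    rw [ea, eb, e0, e1, add_sub_add_left_eq_sub]
    have q1 : (1 : ℝ) ≤ b 1 := by exact_mod_cast hb 0
    have q2 : (1 : ℝ) ≤ finCF (shift (shift a)) (n + 2 * k) :=
      le_trans (by exact_mod_cast ha 1) (le_finCF (a := shift (shift a)) (fun n => ha (n + 2)) _).1
    have q3 : (1 : ℝ) ≤ finCF (shift (shift b)) (m + 2 * k) :=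
      le_trans (by exact_mod_cast hb 1) (le_finCF (a := shift (shift b)) (fun n => hb (n + 2)) _).1
    refine (abs_two_step _ _ _ q1 q2 q3).trans ?_
    rw [pow_succ]
    linarith

lemma tendsto_finCF {a : ℕ → ℕ} (ha : ∀ n, 0 < a (n + 1)) :
    Tendsto (finCF a) atTop (𝓝 (cfValue a)) := by
  have hc : CauchySeq (finCF a) := by
    rw [Metric.cauchySeq_iff']
    intro ε hε
    obtain ⟨k, hk⟩ := exists_pow_lt_of_lt_one hε (by norm_num : (1 / 4 : ℝ) < 1)
    refine ⟨0 + 2 * k, fun n hn => ?_⟩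
    obtain ⟨m, rfl⟩ := Nat.exists_eq_add_of_le' (show 2 * k ≤ n by omega)
    rw [Real.dist_eq]
    exact (abs_finCF_sub_le ha ha k (fun _ _ => rfl) m 0).trans_lt hk
  have he : (contFrac a).convs = finCF a := funext (convs_contFrac ha)
  rw [cfValue, he]
  exact hc.tendsto_limUnder

/-- All letters are positive. -/
def Pos (a : ℕ → ℕ) : Prop := ∀ n, 0 < a n

lemma Pos.shift {a : ℕ → ℕ} (ha : Pos a) : Pos (shift a) := fun n => ha (n + 1)

lemma abs_cfValue_sub_le {a b : ℕ → ℕ} (ha : Pos a) (hb : Pos b) (k : ℕ)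
    (hab : ∀ i ≤ 2 * k, a i = b i) : |cfValue a - cfValue b| ≤ (1 / 4) ^ k := by
  have h1 := (tendsto_add_atTop_iff_nat (2 * k)).2 (tendsto_finCF fun n => ha (n + 1))
  have h2 := (tendsto_add_atTop_iff_nat (2 * k)).2 (tendsto_finCF fun n => hb (n + 1))
  exact le_of_tendsto (h1.sub h2).abs (Eventually.of_forall fun n =>
    abs_finCF_sub_le (fun n => ha (n + 1)) (fun n => hb (n + 1)) k hab n n)

lemma one_le_cfValue {a : ℕ → ℕ} (ha : Pos a) : 1 ≤ cfValue a :=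
  ge_of_tendsto' (tendsto_finCF fun n => ha (n + 1)) fun n =>
    le_trans (by exact_mod_cast ha 0) (le_finCF (fun n => ha (n + 1)) n).1

/-- Positivity is asked only from index 1 on, so that the summand [0, S₋₁, S₋₂, …] of `lambdaZero`
is covered. -/
lemma cfValue_eq' {a : ℕ → ℕ} (ha : ∀ n, 0 < a (n + 1)) :
    cfValue a = a 0 + 1 / cfValue (shift a) := by
  have h1 : Tendsto (fun n => finCF a (n + 1)) atTop (𝓝 (cfValue a)) :=
    (tendsto_add_atTop_iff_nat 1).2 (tendsto_finCF ha)
  have h2 : Tendsto (fun n => finCF a (n + 1)) atTop (𝓝 (a 0 + 1 / cfValue (shift a))) := by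
    have h3 := tendsto_finCF (a := shift a) fun n => ha (n + 1)
    have h4 := one_le_cfValue (a := shift a) ha
    simpa only [one_div, finCF] using (h3.inv₀ (by linarith)).const_add (a 0 : ℝ)
  exact tendsto_nhds_unique h1 h2

lemma cfValue_eq {a : ℕ → ℕ} (ha : Pos a) : cfValue a = a 0 + 1 / cfValue (shift a) :=
  cfValue_eq' fun n => ha (n + 1)

lemma one_lt_cfValue {a : ℕ → ℕ} (ha : Pos a) : 1 < cfValue a := by
  rw [cfValue_eq ha]
  have h1 := one_le_cfValue ha.shift
  have h2 : (1 : ℝ) ≤ a 0 := by exact_mod_cast ha 0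
  have h3 : 0 < 1 / cfValue (shift a) := by positivity
  linarith

lemma cfValue_pos {a : ℕ → ℕ} (ha : Pos a) : 0 < cfValue a := one_pos.trans (one_lt_cfValue ha)

lemma cfValue_lt {a : ℕ → ℕ} (ha : Pos a) : cfValue a < a 0 + 1 := by
  rw [cfValue_eq ha]
  have h1 := one_lt_cfValue ha.shift
  have : 1 / cfValue (shift a) < 1 := by rw [div_lt_one (by linarith)]; exact h1
  linarith

lemma lt_cfValue {a : ℕ → ℕ} (ha : Pos a) : (a 0 : ℝ) < cfValue a := by
  rw [cfValue_eq ha]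
  have := one_div_pos.2 (cfValue_pos ha.shift)
  linarith

lemma floor_cfValue {a : ℕ → ℕ} (ha : Pos a) : ⌊cfValue a⌋ = a 0 := by
  rw [Int.floor_eq_iff]
  have h1 := cfValue_lt ha
  have h2 := lt_cfValue ha
  push_cast
  exact ⟨h2.le, h1⟩

/-- Comparison at the first letter where two sequences differ. -/
lemma cfValue_le_of_first_diff {a b : ℕ → ℕ} (ha : Pos a) (hb : Pos b) (j : ℕ)
    (hab : ∀ i < j, a i = b i) (hj : if Even j then a j < b j else b j < a j) :
    cfValue a ≤ cfValue b := by
  induction j generalizing a b with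
  | zero =>
    simp only [Even.zero, if_true] at hj
    have h1 := cfValue_lt ha
    have h2 := lt_cfValue hb
    have h3 : (a 0 : ℝ) + 1 ≤ b 0 := by exact_mod_cast hj
    linarith
  | succ j ih =>
    have h0 : a 0 = b 0 := hab 0 (by omega)
    have : cfValue (shift b) ≤ cfValue (shift a) := by
      refine ih hb.shift ha.shift (fun i hi => (hab (i + 1) (by omega)).symm) ?_
      by_cases he : Even j
      · simpa [he, shift, Nat.even_add_one] using hj
      · simpa [he, shift, Nat.even_add_one] using hj
    rw [cfValue_eq ha, cfValue_eq hb, h0]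
    have h3 := cfValue_pos hb.shift
    have := one_div_le_one_div_of_le h3 this
    linarith

/-- Infinite descent on the denominator: if the value is p / q, then the next complete quotient is q
/ (p − a₀ q), and it exceeds 1, so |p − a₀ q| < |q|. -/
lemma irrational_cfValue {a : ℕ → ℕ} (ha : Pos a) : Irrational (cfValue a) := by
  rw [irrational_iff_ne_rational]
  intro p q hq h
  have key : ∀ n : ℕ, ∀ a : ℕ → ℕ, Pos a → ∀ p q : ℤ, q.natAbs = n → q ≠ 0 →
      cfValue a ≠ p / q := by
    intro n
    induction n using Nat.strong_induction_on with
    | _ n ih =>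
      intro a ha p q hn hq h
      have hq' : (q : ℝ) ≠ 0 := by exact_mod_cast hq
      have h1 := cfValue_eq ha
      have h2 := one_lt_cfValue ha.shift
      have h3 : (p - a 0 * q : ℝ) * cfValue (shift a) = q := by
        have : (p : ℝ) = cfValue a * q := by rw [h]; field_simp
        rw [this, h1]
        field_simp
        ring
      have h4 : (p - a 0 * q : ℝ) ≠ 0 := fun h0 => by rw [h0, zero_mul] at h3; exact hq' h3.symm
      have h5 : (p - a 0 * q : ℤ) ≠ 0 := by exact_mod_cast h4
      refine ih (p - a 0 * q : ℤ).natAbs ?_ (shift a) ha.shift q (p - a 0 * q) rfl h5 ?_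
      · rw [← hn]
        zify
        have : |(p - a 0 * q : ℝ)| < |(q : ℝ)| := by
          have h6 := congrArg abs h3
          rw [abs_mul, abs_of_pos (cfValue_pos ha.shift)] at h6
          rw [← h6]
          exact lt_mul_of_one_lt_right (abs_pos.2 h4) h2
        exact_mod_cast this
      · push_cast
        rw [eq_div_iff h4, mul_comm]
        exact h3
  exact key _ a ha p q rfl hq h

/-! ### Bi-infinite sequences -/

/-- `[S n, S (n+1), …]` -/
def fwd (S : ℤ → ℕ) (n : ℤ) : ℝ := cfValue fun k : ℕ => S (n + k)

/-- `[S n, S (n-1), …]` -/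
def bwd (S : ℤ → ℕ) (n : ℤ) : ℝ := cfValue fun k : ℕ => S (n - k)

/-- `[S n, S (n+1), …] + [0, S (n-1), S (n-2), …]` -/
def lam (S : ℤ → ℕ) (n : ℤ) : ℝ := fwd S n + 1 / bwd S (n - 1)

/-- All letters are positive. -/
def BPos (S : ℤ → ℕ) : Prop := ∀ n, 0 < S n

/-- The reversed sequence. -/
def reflect (S : ℤ → ℕ) : ℤ → ℕ := fun n => S (-n)

/-- The sequence with `n` moved to the origin. -/
def translate (S : ℤ → ℕ) (n : ℤ) : ℤ → ℕ := fun i => S (n + i)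

variable {S : ℤ → ℕ}

lemma BPos.reflect (hS : BPos S) : BPos (reflect S) := fun n => hS (-n)

lemma fwd_eq (hS : BPos S) (n : ℤ) : fwd S n = S n + 1 / fwd S (n + 1) := by
  rw [fwd, cfValue_eq fun k => hS _]
  simp only [fwd, Nat.cast_zero, add_zero]
  congr 3
  ext k
  simp only [shift]
  congr 1; push_cast; ring

lemma fwd_reflect (S : ℤ → ℕ) (n : ℤ) : fwd (reflect S) n = bwd S (-n) := by
  simp only [fwd, bwd, reflect]
  congr 1; ext k; congr 1; ring

lemma bwd_reflect (S : ℤ → ℕ) (n : ℤ) : bwd (reflect S) n = fwd S (-n) := by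
  simp only [fwd, bwd, reflect]
  congr 1; ext k; congr 1; ring

lemma bwd_eq (hS : BPos S) (n : ℤ) : bwd S n = S n + 1 / bwd S (n - 1) := by
  have := fwd_eq hS.reflect (-n)
  rw [fwd_reflect, fwd_reflect] at this
  simp only [neg_neg, reflect] at this
  rw [this, show -(-n + 1) = n - 1 by ring]

lemma one_lt_fwd (hS : BPos S) (n : ℤ) : 1 < fwd S n := one_lt_cfValue fun _ => hS _

lemma one_lt_bwd (hS : BPos S) (n : ℤ) : 1 < bwd S n := one_lt_cfValue fun _ => hS _

lemma fwd_translate (S : ℤ → ℕ) (n m : ℤ) : fwd (translate S n) m = fwd S (n + m) := by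
  simp only [fwd, translate, add_assoc]

lemma bwd_translate (S : ℤ → ℕ) (n m : ℤ) : bwd (translate S n) m = bwd S (n + m) := by
  simp only [bwd, translate, add_sub_assoc]

lemma lam_translate (S : ℤ → ℕ) (n m : ℤ) : lam (translate S n) m = lam S (n + m) := by
  simp only [lam, fwd_translate, bwd_translate, add_sub_assoc]

lemma lam_eq (hS : BPos S) (n : ℤ) : lam S n = S n + 1 / fwd S (n + 1) + 1 / bwd S (n - 1) := by
  rw [lam, fwd_eq hS]

lemma lam_reflect (hS : BPos S) (n : ℤ) : lam (reflect S) n = lam S (-n) := by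
  rw [lam_eq hS, lam_eq hS.reflect, fwd_reflect, bwd_reflect]
  rw [show -(n + 1) = -n - 1 by ring, show -(n - 1) = -n + 1 by ring]
  simp only [reflect]
  ring

lemma lambdaZero_eq (hS : BPos S) : lambdaZero S = lam S 0 := by
  rw [lambdaZero, lam]
  congr 1
  · simp [fwd]
  · rw [cfValue_eq' fun n => by simpa using hS _]
    simp only [if_true, Nat.cast_zero, zero_add, bwd]
    congr 2
    ext k
    simp only [shift, Nat.succ_ne_zero, if_false]
    congr 1; push_cast; ring

lemma abs_fwd_sub_le {T : ℤ → ℕ} (hS : BPos S) (hT : BPos T) (n m : ℤ) (k : ℕ)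
    (h : ∀ i : ℕ, i ≤ 2 * k → S (n + i) = T (m + i)) :
    |fwd S n - fwd T m| ≤ (1 / 4) ^ k :=
  abs_cfValue_sub_le (fun _ => hS _) (fun _ => hT _) k h

lemma abs_bwd_sub_le {T : ℤ → ℕ} (hS : BPos S) (hT : BPos T) (n m : ℤ) (k : ℕ)
    (h : ∀ i : ℕ, i ≤ 2 * k → S (n - i) = T (m - i)) :
    |bwd S n - bwd T m| ≤ (1 / 4) ^ k :=
  abs_cfValue_sub_le (fun _ => hS _) (fun _ => hT _) k h

lemma abs_lam_sub_le {T : ℤ → ℕ} (hS : BPos S) (hT : BPos T) (n m : ℤ) (k : ℕ)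
    (h : ∀ i : ℤ, |i| ≤ 2 * k + 1 → S (n + i) = T (m + i)) :
    |lam S n - lam T m| ≤ 2 * (1 / 4) ^ k := by
  have h1 := abs_fwd_sub_le hS hT n m k fun i hi => h i (by rw [abs_of_nonneg] <;> omega)
  have h2 := abs_bwd_sub_le hS hT (n - 1) (m - 1) k fun i hi => by
    have := h (-1 - i) (by rw [abs_of_nonpos] <;> omega)
    rw [show n - 1 - (i : ℤ) = n + (-1 - i) by ring, this]; congr 1; ring
  have h3 : |1 / bwd S (n - 1) - 1 / bwd T (m - 1)| ≤ |bwd S (n - 1) - bwd T (m - 1)| := by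
    have p1 := one_lt_bwd hS (n - 1)
    have p2 := one_lt_bwd hT (m - 1)
    rw [div_sub_div _ _ (by linarith) (by linarith), abs_div, div_le_iff₀ (by positivity),
      one_mul, mul_one, abs_sub_comm]
    exact le_mul_of_one_le_right (abs_nonneg _) (by rw [abs_of_pos] <;> nlinarith)
  have h4 : lam S n - lam T m = (fwd S n - fwd T m) +
      (1 / bwd S (n - 1) - 1 / bwd T (m - 1)) := by simp only [lam]; ring
  rw [h4]
  exact (abs_add_le _ _).trans (by linarith)

end MarkovLagrange

end

noncomputable section

namespace MarkovLagrange

/-! ### Values of binary quadratic forms -/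

variable {S : ℤ → ℕ}

lemma lam_pos (hS : BPos S) (n : ℤ) : 0 < lam S n := by
  have h1 := one_lt_fwd hS n
  have h2 := one_lt_bwd hS (n - 1)
  have : 0 < 1 / bwd S (n - 1) := by positivity
  rw [lam]; linarith

/-- The form with roots `[S n, S (n+1), …]` and `-[0, S (n-1), …]`, of discriminant `1`. -/
def unitForm (S : ℤ → ℕ) (n x y : ℤ) : ℝ :=
  (x - fwd S n * y) * (x + 1 / bwd S (n - 1) * y) / lam S n

/-- The unimodular substitution (x, y) ↦ (y, x − S n · y) is one step of the continued fraction: it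
carries the pair of roots at n to the pair at n + 1, with a change of sign. -/
lemma unitForm_succ (hS : BPos S) (n x y : ℤ) :
    unitForm S n x y = -unitForm S (n + 1) y (x - S n * y) := by
  have h1 := one_lt_fwd hS (n + 1)
  have h2 := one_lt_bwd hS (n - 1)
  have h3 : 0 < (S n : ℝ) := by exact_mod_cast hS n
  have h4 := lam_pos hS n
  have h5 := lam_pos hS (n + 1)
  rw [unitForm, unitForm, ← neg_div, div_eq_div_iff h4.ne' h5.ne', add_sub_cancel_right]
  simp only [lam]
  rw [add_sub_cancel_right, fwd_eq hS n, bwd_eq hS n]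
  have h6 : (S n : ℝ) + 1 / bwd S (n - 1) ≠ 0 := by positivity
  push_cast
  generalize fwd S (n + 1) = f at *
  generalize bwd S (n - 1) = b at *
  have h7 : f ≠ 0 := by positivity
  have h8 : b ≠ 0 := by positivity
  have h9 : (S n : ℝ) * b + 1 ≠ 0 := by positivity
  field_simp
  ring

lemma convergent_fwd_succ (hS : BPos S) (n : ℤ) (k : ℕ) :
    (fwd S n).convergent (k + 1) = S n + ((fwd S (n + 1)).convergent k)⁻¹ := by
  have h1 : ⌊fwd S n⌋ = S n := by
    have := floor_cfValue (a := fun k : ℕ => S (n + k)) fun k => hS _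
    simpa [fwd] using this
  rw [Real.convergent_succ, h1]
  congr 3
  rw [Int.fract, h1, fwd_eq hS n]
  simp

lemma convergent_fwd_zero (hS : BPos S) (n : ℤ) : (fwd S n).convergent 0 = S n := by
  have := floor_cfValue (a := fun k : ℕ => S (n + k)) fun k => hS _
  rw [Real.convergent_zero, fwd, this]
  simp

lemma convergent_fwd_pos (hS : BPos S) (n : ℤ) (k : ℕ) : 0 < (fwd S n).convergent k := by
  have h3 : 0 < (S n : ℚ) := by exact_mod_cast hS n
  induction k generalizing n with
  | zero => rw [convergent_fwd_zero hS]; exact h3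
  | succ k ih =>
    have h4 : 0 < (S (n + 1) : ℚ) := by exact_mod_cast hS (n + 1)
    rw [convergent_fwd_succ hS]
    have := inv_pos.2 (ih (n + 1) h4)
    linarith

/-- The value of the form at a convergent. -/
lemma abs_unitForm_convergent (hS : BPos S) (n : ℤ) (k : ℕ) (x y : ℤ) (hxy : IsCoprime x y)
    (hy : y ≠ 0) (h : (x / y : ℚ) = (fwd S n).convergent k) :
    |unitForm S n x y| = 1 / lam S (n + k + 1) := by
  have hy' : (y : ℚ) ≠ 0 := by exact_mod_cast hy
  induction k generalizing n x y with
  | zero =>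
    rw [convergent_fwd_zero hS, div_eq_iff hy'] at h
    have hx : x = S n * y := by exact_mod_cast h
    have hu : IsUnit y := hxy.isUnit_of_dvd' ⟨S n, by rw [hx]; ring⟩ dvd_rfl
    have hyy : (y : ℝ) * y = 1 := by
      rcases Int.isUnit_iff.1 hu with h | h <;> simp [h]
    rw [unitForm_succ hS, hx, sub_self, abs_neg, unitForm]
    simp only [Int.cast_zero, mul_zero, sub_zero, add_zero, hyy, Nat.cast_zero]
    rw [abs_of_pos (one_div_pos.2 (lam_pos hS _))]
  | succ k ih =>
    rw [convergent_fwd_succ hS] at h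
    have hc := convergent_fwd_pos hS (n + 1) k
    set c := (fwd S (n + 1)).convergent k with hcdef
    have h1 : ((x - S n * y : ℤ) : ℚ) = y / c := by
      rw [div_eq_iff hy'] at h
      push_cast
      rw [h]
      field_simp
      ring
    have h2 : ((x - S n * y : ℤ) : ℚ) ≠ 0 := by rw [h1]; exact div_ne_zero hy' hc.ne'
    have h3 : x - S n * y ≠ 0 := by exact_mod_cast h2
    rw [unitForm_succ hS, abs_neg, ih (n + 1) y (x - S n * y) ?_ h3 ?_ h2]
    · congr 2; push_cast; ring
    · have := (hxy.symm).add_mul_left_right (-(S n : ℤ))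
      convert! this using 1
      ring
    · rw [h1, ← hcdef]; field_simp

/-! ### A criterion for the Markov spectrum -/

/-- The roots of the form are `fwd S 0` and `-1 / bwd S (-1)`, at distance `lam S 0`. The last
hypothesis places x / y on the side of their midpoint where `fwd S 0` lies; the other side is
obtained later by reversing the sequence. -/
lemma one_le_abs_form (hS : BPos S) (hc : 3 ≤ lam S 0) (hl : ∀ n, lam S n ≤ lam S 0)
    (x y : ℤ) (hxy : IsCoprime x y) (hy : y ≠ 0)
    (h : -(lam S 0 / 2) ≤ (x / y : ℝ) - fwd S 0) :
    1 ≤ |(x - fwd S 0 * y) * (x + 1 / bwd S (-1) * y)| := by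
  have hy' : (y : ℝ) ≠ 0 := by exact_mod_cast hy
  have hy2 : (1 : ℝ) ≤ (y : ℝ) ^ 2 := by
    have : (0 : ℤ) < y ^ 2 := by positivity
    exact_mod_cast this
  set c := lam S 0 with hcdef
  have hc' : c = fwd S 0 + 1 / bwd S (-1) := by rw [hcdef, lam]; simp
  set s := fwd S 0 - x / y with hs
  have e : (x - fwd S 0 * y) * (x + 1 / bwd S (-1) * y) = -(s * (c - s)) * (y : ℝ) ^ 2 := by
    rw [hc', hs]; field_simp; ring
  -- Either Legendre's criterion makes x / y a convergent, where the form takes a value `lam S 0 /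
  -- lam S m ≥ 1` in absolute value, or x / y is far enough from both roots for a direct estimate.
  by_cases hcase : |s| < 1 / (2 * (y : ℝ) ^ 2)
  · have hden : ((x / y : ℚ).den : ℝ) ^ 2 = (y : ℝ) ^ 2 := by
      have := Rat.den_div_eq_of_coprime (a := x * y.sign) (b := |y|) (abs_pos.2 hy) ?_
      · have e1 : ((x * y.sign : ℤ) : ℚ) / (|y| : ℤ) = x / y := by
          rcases lt_or_gt_of_ne hy with h0 | h0
          · rw [Int.sign_eq_neg_one_of_neg h0, abs_of_neg h0]; push_cast
            rw [mul_neg_one, neg_div_neg_eq]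
          · rw [Int.sign_eq_one_of_pos h0, abs_of_pos h0]; simp
        rw [e1] at this
        have e2 : ((x / y : ℚ).den : ℝ) = |(y : ℝ)| := by exact_mod_cast this
        rw [e2, sq_abs]
      · rw [Int.isCoprime_iff_nat_coprime] at hxy
        rw [Int.natAbs_mul, Int.natAbs_sign_of_ne_zero hy, mul_one, Int.natAbs_abs]
        exact hxy
    obtain ⟨k, hk⟩ := Real.exists_rat_eq_convergent (ξ := fwd S 0) (q := x / y) (by
      rw [hden]; push_cast; exact hcase)
    have h1 := abs_unitForm_convergent hS 0 k x y hxy hy hk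
    rw [unitForm, abs_div, abs_of_pos (lam_pos hS 0), div_eq_div_iff (lam_pos hS _).ne'
      (lam_pos hS _).ne', one_mul, zero_sub] at h1
    have h2 := hl (0 + k + 1)
    have h3 := lam_pos hS (0 + k + 1)
    by_contra h4
    push Not at h4
    nlinarith
  · push Not at hcase
    have h0 : 1 / (2 * (y : ℝ) ^ 2) * (y : ℝ) ^ 2 = 1 / 2 := by field_simp
    have h1 : 1 / (2 * (y : ℝ) ^ 2) ≤ 1 / 2 := by
      rw [div_le_div_iff₀ (by positivity) (by norm_num)]; linarith
    have hu : 0 < 1 / (2 * (y : ℝ) ^ 2) := by positivity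
    set t := 1 / (2 * (y : ℝ) ^ 2)
    have h2 : s ≤ c / 2 := by rw [hs]; linarith
    rw [e, abs_mul, abs_neg, abs_mul, abs_of_pos (by positivity : (0 : ℝ) < (y : ℝ) ^ 2),
      abs_of_pos (by linarith : 0 < c - s)]
    -- Here t ≤ |s| and t ≤ 1/2. On the side s > 0 one has s ≤ c / 2, and c ≥ 3 suffices; on the
    -- side s < 0 the second factor exceeds c.
    have h3 : 2 * t ≤ |s| * (c - s) := by
      rcases abs_cases s with ⟨h4, h5⟩ | ⟨h4, h5⟩
      · rw [h4] at hcase ⊢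
        nlinarith [mul_nonneg (sub_nonneg.2 hcase) (by linarith : (0 : ℝ) ≤ c / 2 - s)]
      · nlinarith
    nlinarith

lemma lam_mem_markovSpectrum (hS : BPos S) (hc : 3 ≤ lam S 0) (hl : ∀ n, lam S n ≤ lam S 0) :
    lam S 0 ∈ markovSpectrum := by
  have hf := one_lt_fwd hS 0
  have hc' : lam S 0 = fwd S 0 + 1 / bwd S (-1) := by rw [lam]; simp
  have hmain : ∀ x y : ℤ, IsCoprime x y →
      1 ≤ |((x : ℝ) - fwd S 0 * y) * (x + 1 / bwd S (-1) * y)| := by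
    intro x y hxy
    by_cases hy : y = 0
    · subst hy
      have hx : IsUnit x := isCoprime_zero_right.1 hxy
      have : (x : ℝ) * x = 1 := by rcases Int.isUnit_iff.1 hx with h | h <;> simp [h]
      simp [this]
    have hy' : (y : ℝ) ≠ 0 := by exact_mod_cast hy
    by_cases h : -(lam S 0 / 2) ≤ (x / y : ℝ) - fwd S 0
    · exact one_le_abs_form hS hc hl x y hxy hy h
    -- Reversal combined with (x, y) ↦ (S 0 · y − x, y) exchanges the two linear factors up to sign,
    -- which brings the other half-line to the case already treated.
    · push Not at h
      have hr : ∀ n, lam (reflect S) n ≤ lam (reflect S) 0 := fun n => by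
        rw [lam_reflect hS, lam_reflect hS]; exact hl _
      have e0 : lam (reflect S) 0 = lam S 0 := by rw [lam_reflect hS]; simp
      have e1 : fwd (reflect S) 0 = S 0 + 1 / bwd S (-1) := by
        rw [fwd_reflect, neg_zero, bwd_eq hS]; simp
      have e2 : fwd S 0 = S 0 + 1 / fwd S 1 := by rw [fwd_eq hS]; simp
      have e3 : bwd (reflect S) (-1) = fwd S 1 := by rw [bwd_reflect, neg_neg]
      have := one_le_abs_form hS.reflect (by rw [e0]; exact hc) hr (S 0 * y - x) y ?_ hy ?_
      · convert this using 2
        rw [e1, e2, e3]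
        push_cast
        ring
      · have := hxy.neg_left.add_mul_left_left (S 0 : ℤ)
        convert! this using 1
        ring
      · rw [e0, e1]
        push_cast
        rw [sub_div, mul_div_cancel_right₀ _ hy']
        linarith
  have hall : ∀ x y : ℤ, (x, y) ≠ (0, 0) →
      1 ≤ |((x : ℝ) - fwd S 0 * y) * (x + 1 / bwd S (-1) * y)| := by
    intro x y hxy
    have hg : Int.gcd x y ≠ 0 := by
      rw [Ne, Int.gcd_eq_zero_iff]; simpa using hxy
    obtain ⟨x', y', hco, hx, hy⟩ := Int.exists_gcd_one (Nat.pos_of_ne_zero hg)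
    have h1 := hmain x' y' (Int.isCoprime_iff_gcd_eq_one.2 hco)
    have hg1 : (1 : ℝ) ≤ (Int.gcd x y : ℝ) := by exact_mod_cast Nat.one_le_iff_ne_zero.2 hg
    have e : ((x : ℝ) - fwd S 0 * y) * (x + 1 / bwd S (-1) * y) =
        (Int.gcd x y : ℝ) ^ 2 * (((x' : ℝ) - fwd S 0 * y') * (x' + 1 / bwd S (-1) * y')) := by
      have hx' : (x : ℝ) = x' * (Int.gcd x y : ℝ) := by exact_mod_cast hx
      have hy' : (y : ℝ) = y' * (Int.gcd x y : ℝ) := by exact_mod_cast hy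
      generalize (Int.gcd x y : ℝ) = g at *
      rw [hx', hy']; ring
    rw [e, abs_mul, abs_of_pos (by positivity)]
    nlinarith
  set b := 1 / bwd S (-1) - fwd S 0 with hb
  set c := -(fwd S 0 * (1 / bwd S (-1))) with hcd
  have hform : ∀ x y : ℤ, 1 * (x : ℝ) ^ 2 + b * x * y + c * (y : ℝ) ^ 2 =
      ((x : ℝ) - fwd S 0 * y) * (x + 1 / bwd S (-1) * y) := fun x y => by rw [hb, hcd]; ring
  have hdisc : b ^ 2 - 4 * 1 * c = lam S 0 ^ 2 := by rw [hc', hb, hcd]; ring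
  have hinf : formInf 1 b c = 1 := by
    rw [formInf]
    have hne : Nonempty {v : ℤ × ℤ // v ≠ (0, 0)} := ⟨⟨(1, 0), by simp⟩⟩
    apply le_antisymm
    · refine ciInf_le_of_le ⟨0, ?_⟩ ⟨(1, 0), by simp⟩ (by simp)
      rintro _ ⟨v, rfl⟩
      positivity
    · refine le_ciInf fun v => ?_
      rw [hform]
      exact hall _ _ v.2
  refine ⟨1, b, c, by rw [hdisc]; positivity, by rw [hinf]; exact one_pos, ?_⟩
  rw [hdisc, hinf, div_one, Real.sqrt_sq (by linarith)]

end MarkovLagrange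

end

noncomputable section

namespace MarkovLagrange

/-! ### The approximation constant of an irrational number -/

variable {S : ℤ → ℕ}

/-- A sequence of complete quotients determines the continued fraction. -/
lemma eq_cfValue_of_complete_quotients {a : ℕ → ℕ} (ha : Pos a) (x : ℕ → ℝ)
    (hx1 : ∀ n, 1 ≤ x n) (hx : ∀ n, x n = a n + 1 / x (n + 1)) : x 0 = cfValue a := by
  have key : ∀ k : ℕ, ∀ a : ℕ → ℕ, Pos a → ∀ x : ℕ → ℝ, (∀ n, 1 ≤ x n) →
      (∀ n, x n = a n + 1 / x (n + 1)) → |x 0 - cfValue a| ≤ (1 / 4) ^ k := by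
    intro k
    induction k with
    | zero =>
      intro a ha x hx1 hx
      have h1 := cfValue_lt ha
      have h2 := lt_cfValue ha
      have h3 : 1 / x 1 ≤ 1 := by rw [div_le_one (by linarith [hx1 1])]; exact hx1 1
      have h4 : 0 < 1 / x 1 := one_div_pos.2 (by linarith [hx1 1])
      rw [pow_zero, hx 0, zero_add, abs_le]
      constructor <;> linarith
    | succ k ih =>
      intro a ha x hx1 hx
      have h := ih _ ha.shift.shift (fun n => x (n + 2)) (fun n => hx1 _) fun n => hx _
      have h2 := one_lt_cfValue ha.shift.shift
      rw [hx 0, hx (0 + 1), cfValue_eq ha, cfValue_eq ha.shift, add_sub_add_left_eq_sub]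
      refine (abs_two_step _ _ _ (by exact_mod_cast ha 1) (hx1 _) h2.le).trans ?_
      rw [pow_succ]
      have : |x (0 + 1 + 1) - cfValue (shift (shift a))| ≤ (1 / 4) ^ k := h
      linarith
  have h0 : Tendsto (fun k : ℕ => (1 / 4 : ℝ) ^ k) atTop (𝓝 0) :=
    tendsto_pow_atTop_nhds_zero_of_lt_one (by norm_num) (by norm_num)
  have := ge_of_tendsto' h0 fun k => key k a ha x hx1 hx
  exact sub_eq_zero.1 (abs_eq_zero.1 (le_antisymm this (abs_nonneg _)))

/-- The complete quotients of an irrational number. -/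
def completeQuotient (α : ℝ) : ℕ → ℝ
  | 0 => (Int.fract α)⁻¹
  | n + 1 => (Int.fract (completeQuotient α n))⁻¹

lemma irrational_inv_fract {α : ℝ} (h : Irrational α) : Irrational (Int.fract α)⁻¹ := by
  rw [irrational_inv_iff]
  exact h.sub_intCast _

lemma one_lt_inv_fract {α : ℝ} (h : Irrational α) : 1 < (Int.fract α)⁻¹ := by
  have h1 : 0 < Int.fract α := Int.fract_pos.2 fun h' => h ⟨⌊α⌋, h'.symm⟩
  exact (one_lt_inv₀ h1).2 (Int.fract_lt_one α)

lemma irrational_completeQuotient {α : ℝ} (h : Irrational α) (n : ℕ) :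
    Irrational (completeQuotient α n) := by
  induction n with
  | zero => exact irrational_inv_fract h
  | succ n ih => exact irrational_inv_fract ih

lemma one_lt_completeQuotient {α : ℝ} (h : Irrational α) (n : ℕ) : 1 < completeQuotient α n := by
  cases n with
  | zero => exact one_lt_inv_fract h
  | succ n => exact one_lt_inv_fract (irrational_completeQuotient h n)

/-- Every irrational number has a continued fraction expansion. -/
lemma exists_expansion {α : ℝ} (h : Irrational α) :
    ∃ S : ℤ → ℕ, BPos S ∧ α = ⌊α⌋ + 1 / fwd S 1 := by
  have hpos : ∀ n, 0 < ⌊completeQuotient α n⌋₊ := fun n =>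
    Nat.floor_pos.2 (one_lt_completeQuotient h n).le
  -- Only the letters at indices ≥ 1 belong to α; the left half is filled with 1, a choice with no
  -- effect on the limsup.
  refine ⟨fun i => if 1 ≤ i then ⌊completeQuotient α (i - 1).toNat⌋₊ else 1, fun i => ?_, ?_⟩
  · dsimp only
    split_ifs
    · exact hpos _
    · exact one_pos
  · have : completeQuotient α 0 = cfValue fun k => ⌊completeQuotient α k⌋₊ := by
      refine eq_cfValue_of_complete_quotients hpos _ (fun n => (one_lt_completeQuotient h n).le) ?_
      intro n
      have h0 := (zero_lt_one.trans (one_lt_completeQuotient h n)).le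
      rw [completeQuotient, one_div, inv_inv, natCast_floor_eq_intCast_floor h0]
      exact (Int.floor_add_fract _).symm
    have e : (fwd (fun i => if 1 ≤ i then ⌊completeQuotient α (i - 1).toNat⌋₊ else 1) 1) =
        completeQuotient α 0 := by
      rw [this, fwd]
      congr 1
      ext k
      have : (1 : ℤ) ≤ 1 + k := by omega
      rw [if_pos this]
      congr 3
      omega
    rw [e, completeQuotient, one_div, inv_inv]
    exact (Int.floor_add_fract _).symm

lemma convergent_expansion (hS : BPos S) {α : ℝ} {a : ℤ} (hα : α = a + 1 / fwd S 1) (k : ℕ) :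
    α.convergent (k + 1) = a + ((fwd S 1).convergent k)⁻¹ := by
  have h1 := one_lt_fwd hS 1
  have h2 : ⌊α⌋ = a := by
    rw [Int.floor_eq_iff, hα]
    have h3 : 0 < 1 / fwd S 1 := by positivity
    have h4 : 1 / fwd S 1 < 1 := by rw [div_lt_one (by linarith)]; exact h1
    constructor <;> linarith
  rw [Real.convergent_succ, Int.fract, h2, hα]
  simp

/-- The factor by which `1 / |q (q α - p)|` differs from `lam`. -/
def distortion (S : ℤ → ℕ) (a : ℤ) (t : ℝ) : ℝ :=
  (1 + 1 / bwd S 0 * (t - a)) * fwd S 1 / lam S 1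

lemma distortion_self (hS : BPos S) {α : ℝ} {a : ℤ} (hα : α = a + 1 / fwd S 1) :
    distortion S a α = 1 := by
  have h1 := one_lt_fwd hS 1
  have h2 := one_lt_bwd hS 0
  have h3 := lam_pos hS 1
  rw [distortion, div_eq_one_iff_eq h3.ne', lam, hα]
  norm_num
  field_simp

lemma approximation_convergent (hS : BPos S) {α : ℝ} {a : ℤ} (hα : α = a + 1 / fwd S 1) (k : ℕ)
    (p q : ℤ) (hpq : IsCoprime p q) (hq : q ≠ 0) (h : (p / q : ℚ) = α.convergent (k + 1)) :
    1 / |(q : ℝ) * (q * α - p)| = |distortion S a (p / q)| * lam S (k + 2) := by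
  have hq' : (q : ℚ) ≠ 0 := by exact_mod_cast hq
  have hqR : (q : ℝ) ≠ 0 := by exact_mod_cast hq
  rw [convergent_expansion hS hα] at h
  have hc := convergent_fwd_pos hS 1 k
  have h1 : ((p - a * q : ℤ) : ℚ) = q / (fwd S 1).convergent k := by
    rw [div_eq_iff hq'] at h
    push_cast
    rw [h]
    field_simp
    ring
  have h2 : ((p - a * q : ℤ) : ℚ) ≠ 0 := by rw [h1]; exact div_ne_zero hq' hc.ne'
  have h3 : p - a * q ≠ 0 := by exact_mod_cast h2
  have h4 := abs_unitForm_convergent hS 1 k q (p - a * q) (by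
    have := hpq.symm.add_mul_left_right (-a)
    convert! this using 1
    ring) h3 (by rw [h1]; field_simp)
  have e : unitForm S 1 q (p - a * q) = distortion S a (p / q) * (q * (q * α - p)) := by
    have h5 := one_lt_fwd hS 1
    have h6 := one_lt_bwd hS 0
    have h7 := lam_pos hS 1
    rw [unitForm, distortion, hα]
    push_cast
    norm_num
    generalize fwd S 1 = f at *
    generalize bwd S 0 = b at *
    field_simp
    ring
  rw [e, abs_mul, show (1 : ℤ) + k + 1 = k + 2 by ring] at h4
  have h8 := lam_pos hS (k + 2)
  have h9 : |distortion S a (p / q)| * |(q : ℝ) * (q * α - p)| * lam S (k + 2) = 1 := by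
    rw [h4]; field_simp
  have h10 : |(q : ℝ) * (q * α - p)| ≠ 0 := fun h0 => by rw [h0] at h9; simp at h9
  rw [div_eq_iff h10, ← h9]
  ring

lemma continuous_distortion (S : ℤ → ℕ) (a : ℤ) : Continuous (distortion S a) := by
  unfold distortion
  fun_prop

/-! ### The limsup over pairs of integers in terms of `lam`. -/

lemma irrational_expansion (hS : BPos S) {α : ℝ} {a : ℤ} (hα : α = a + 1 / fwd S 1) :
    Irrational α := by
  have h : Irrational (fwd S 1) := irrational_cfValue fun k => hS _
  rw [hα, one_div]
  exact (irrational_inv_iff.2 h).intCast_add a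

lemma tendsto_convergent (α : ℝ) : Tendsto (fun k => (α.convergent k : ℝ)) atTop (𝓝 α) := by
  have := GenContFract.of_convergence α
  refine this.congr fun k => ?_
  exact Real.convs_eq_convergent α k

lemma isOpen_not_int : IsOpen {x : ℝ | ∀ m : ℤ, (m : ℝ) ≠ x} := by
  have : {x : ℝ | ∀ m : ℤ, (m : ℝ) ≠ x} = (Set.range ((↑) : ℤ → ℝ))ᶜ := by ext x; simp
  rw [this]
  exact Int.isClosedEmbedding_coe_real.isClosed_range.isOpen_compl

lemma tendsto_cofinite_of_eventually_ne {f : ℕ → ℤ} (h : ∀ d, ∀ᶠ k in atTop, f k ≠ d) :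
    Tendsto f atTop cofinite := by
  rw [Tendsto, le_cofinite_iff_eventually_ne]
  exact h

/-- A fixed nonzero numerator d would make d / r k an integer, though it tends to the irrational d /
α; a fixed denominator d would make d · r k an integer tending to d α. The integers are closed, so
neither happens for large k. -/
lemma tendsto_num_den {α : ℝ} (hα : Irrational α) {r : ℕ → ℚ}
    (hr : Tendsto (fun k => (r k : ℝ)) atTop (𝓝 α)) :
    Tendsto (fun k => ((r k).num, ((r k).den : ℤ))) atTop
      ((cofinite : Filter ℤ) ×ˢ (cofinite : Filter ℤ)) := by
  refine Tendsto.prodMk (tendsto_cofinite_of_eventually_ne fun d => ?_)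
    (tendsto_cofinite_of_eventually_ne fun d => ?_)
  · by_cases hd : d = 0
    · have : ∀ᶠ k in atTop, (r k : ℝ) ≠ 0 := hr.eventually_ne hα.ne_zero
      filter_upwards [this] with k hk h
      rw [hd, Rat.num_eq_zero] at h
      exact hk (by rw [h]; simp)
    · have h1 : Tendsto (fun k => (d : ℝ) / r k) atTop (𝓝 (d / α)) :=
        tendsto_const_nhds.div hr hα.ne_zero
      have h2 : Irrational (d / α) := by
        rw [div_eq_mul_inv]
        exact (irrational_inv_iff.2 hα).intCast_mul hd
      have h3 := h1.eventually (isOpen_not_int.mem_nhds fun m hm => h2 ⟨m, by simpa using hm⟩)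
      filter_upwards [h3] with k hk h
      refine hk (r k).den ?_
      have hn : ((r k).num : ℝ) ≠ 0 := by rw [h]; exact_mod_cast hd
      rw [← h, Rat.cast_def]
      push_cast
      field_simp
  · by_cases hd : d = 0
    · exact Eventually.of_forall fun k h => (r k).den_ne_zero (by rw [hd] at h; exact_mod_cast h)
    · have h1 : Tendsto (fun k => (d : ℝ) * r k) atTop (𝓝 (d * α)) := hr.const_mul _
      have h2 : Irrational (d * α) := hα.intCast_mul hd
      have h3 := h1.eventually (isOpen_not_int.mem_nhds fun m hm => h2 ⟨m, by simpa using hm⟩)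
      filter_upwards [h3] with k hk h
      refine hk (r k).num ?_
      have hn : ((r k).den : ℝ) ≠ 0 := by exact_mod_cast (r k).den_ne_zero
      have : (d : ℝ) = (r k).den := by rw [← h]; simp
      rw [this, Rat.cast_def]
      field_simp

lemma isCoprime_num_den (r : ℚ) : IsCoprime r.num (r.den : ℤ) := by
  rw [Int.isCoprime_iff_nat_coprime]
  simpa using r.reduced

/-- The convergents are admissible test pairs for the limsup, and along them the quotient is `lam`
times a distortion factor tending to 1 in absolute value. -/
lemma le_bestConstant (hS : BPos S) {α : ℝ} {a : ℤ} (hα : α = a + 1 / fwd S 1) {c : ℝ}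
    (h : ∃ᶠ k : ℕ in atTop, c ≤ lam S k) : (c : EReal) ≤ bestConstant α := by
  refine EReal.ge_of_forall_gt_iff_ge.1 fun z hz => ?_
  have hz' : z < c := EReal.coe_lt_coe_iff.1 hz
  refine le_limsup_of_frequently_le ?_
  have hr : Tendsto (fun k => (α.convergent (k + 1) : ℝ)) atTop (𝓝 α) :=
    (tendsto_add_atTop_iff_nat 1).2 (tendsto_convergent α)
  refine (tendsto_num_den (irrational_expansion hS hα) hr).frequently ?_
  have hd : ∀ᶠ k in atTop, z < |distortion S a (α.convergent (k + 1))| * c := by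
    have h1 : Tendsto (fun k => |distortion S a (α.convergent (k + 1))| * c) atTop
        (𝓝 (|distortion S a α| * c)) :=
      (((continuous_distortion S a).tendsto α).comp hr).abs.mul_const c
    rw [distortion_self hS hα, abs_one, one_mul] at h1
    exact h1.eventually (lt_mem_nhds hz')
  have h2 : ∃ᶠ k : ℕ in atTop, c ≤ lam S (k + 2) := by
    have : ∃ᶠ k : ℕ in atTop, c ≤ lam S ((k + 2 : ℕ) : ℤ) := by
      rw [frequently_atTop] at h ⊢
      intro n
      obtain ⟨k, hk, hk'⟩ := h (n + 2)
      exact ⟨k - 2, by omega, by rwa [Nat.sub_add_cancel (by omega)]⟩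
    simpa using this
  refine (h2.and_eventually hd).mono fun k hk => ?_
  have hrat : ((α.convergent (k + 1)).num / ((α.convergent (k + 1)).den : ℤ) : ℚ) =
      α.convergent (k + 1) := by push_cast; exact Rat.num_div_den _
  have e := approximation_convergent hS hα k _ _ (isCoprime_num_den (α.convergent (k + 1)))
    (by exact_mod_cast (α.convergent (k + 1)).den_ne_zero) hrat
  have e2 : ((α.convergent (k + 1)).num : ℝ) / (((α.convergent (k + 1)).den : ℤ) : ℝ) =
      (α.convergent (k + 1) : ℝ) := by exact_mod_cast congrArg (Rat.cast : ℚ → ℝ) hrat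
  rw [e2] at e
  rw [EReal.coe_le_coe_iff, e]
  exact hk.2.le.trans (mul_le_mul_of_nonneg_left hk.1 (abs_nonneg _))

lemma approximation_scale (α : ℝ) (q p m : ℝ) :
    1 / |(m * q) * ((m * q) * α - m * p)| = 1 / m ^ 2 * (1 / |q * (q * α - p)|) := by
  rw [show (m * q) * ((m * q) * α - m * p) = m ^ 2 * (q * (q * α - p)) by ring, abs_mul,
    abs_of_nonneg (sq_nonneg m), one_div_mul_one_div]

/-- The bound c ≥ 2 is what Legendre's criterion needs: a pair violating the estimate satisfies |α −
p / q| < 1 / (2 q²), hence is a multiple of a convergent. -/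
lemma bestConstant_le (hS : BPos S) {α : ℝ} {a : ℤ} (hα : α = a + 1 / fwd S 1) {c : ℝ}
    (hc : 2 ≤ c) (h : ∀ᶠ k : ℕ in atTop, lam S k ≤ c) : bestConstant α ≤ c := by
  have hirr := irrational_expansion hS hα
  refine EReal.le_of_forall_lt_iff_le.1 fun z hz => ?_
  have hz' : c < z := EReal.coe_lt_coe_iff.1 hz
  obtain ⟨N, hN⟩ := eventually_atTop.1 h
  -- Near α the distortion is harmless, and the finitely many initial convergents, at which `lam` is
  -- not controlled, are avoided.
  have hnear : ∀ᶠ t in 𝓝 α, |distortion S a t| * c < z ∧ ∀ k < N + 1, t ≠ α.convergent k := by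
    refine Eventually.and ?_ ?_
    · have h1 : Tendsto (fun t => |distortion S a t| * c) (𝓝 α) (𝓝 (|distortion S a α| * c)) :=
        ((continuous_distortion S a).tendsto α).abs.mul_const c
      rw [distortion_self hS hα, abs_one, one_mul] at h1
      exact h1.eventually (gt_mem_nhds hz')
    · have := (eventually_all_finset (Finset.range (N + 1)) (l := 𝓝 α)
        (p := fun k t => t ≠ α.convergent k)).2 fun k _ => by
          exact eventually_ne_nhds fun h0 => hirr ⟨_, h0.symm⟩
      filter_upwards [this] with t ht k hk using ht k (Finset.mem_range.2 hk)
  obtain ⟨ε, hε, hball⟩ := Metric.eventually_nhds_iff.1 hnear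
  have hq : ∀ᶠ q : ℤ in cofinite, 1 / (2 * (q : ℝ) ^ 2) < ε := by
    have h1 : Tendsto (fun q : ℤ => |(q : ℝ)|) cofinite atTop :=
      tendsto_norm_cocompact_atTop.comp Int.tendsto_coe_cofinite
    filter_upwards [h1.eventually (eventually_gt_atTop (max 1 (1 / ε)))] with q hq
    have h2 := (le_max_left _ _).trans_lt hq
    have h3 := (le_max_right _ _).trans_lt hq
    rw [← sq_abs]
    rw [div_lt_iff₀ hε] at h3
    rw [div_lt_iff₀ (by positivity)]
    nlinarith
  refine limsup_le_of_le (h := ?_)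
  filter_upwards [hq.prod_inr (cofinite : Filter ℤ)] with v hv
  obtain ⟨p, q⟩ := v
  simp only at hv ⊢
  rw [EReal.coe_le_coe_iff]
  by_contra hcon
  push Not at hcon
  -- For q = 0 the quotient is 1 / 0 = 0 by convention, so the estimate cannot fail there; `hpos`
  -- uses the same remark.
  have hq0 : q ≠ 0 := by
    rintro rfl
    simp at hcon
    linarith
  have hq' : (q : ℝ) ≠ 0 := by exact_mod_cast hq0
  set r : ℚ := p / q with hr
  have hrR : (r : ℝ) = p / q := by rw [hr]; push_cast; rfl
  have hpos : 0 < |(q : ℝ) * (q * α - p)| := by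
    by_contra h0
    have : |(q : ℝ) * (q * α - p)| = 0 := le_antisymm (not_lt.1 h0) (abs_nonneg _)
    rw [this] at hcon
    simp at hcon
    linarith
  have hdist : |α - r| < 1 / (2 * (q : ℝ) ^ 2) := by
    rw [lt_div_iff₀ hpos] at hcon
    have e : |(q : ℝ) * (q * α - p)| = (q : ℝ) ^ 2 * |α - r| := by
      rw [hrR, ← abs_of_nonneg (sq_nonneg (q : ℝ)), ← abs_mul]
      congr 1
      field_simp
    rw [e] at hcon hpos
    rw [lt_div_iff₀ (by positivity)]
    nlinarith
  obtain ⟨hz1, hN1⟩ := hball (y := (r : ℝ)) (by rw [dist_comm, Real.dist_eq]; exact hdist.trans hv)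
  obtain ⟨m, hm1, hm2⟩ : ∃ m : ℤ, p = m * r.num ∧ q = m * r.den := by
    obtain ⟨m, h1, h2⟩ := Rat.num_den_mk hq0 (show r = Rat.divInt p q by
      rw [hr, Rat.divInt_eq_div])
    exact ⟨m, h1, h2⟩
  have hm0 : m ≠ 0 := by rintro rfl; simp at hm2; exact hq0 hm2
  have hm3 : (1 : ℝ) ≤ (m : ℝ) ^ 2 := by
    have : (0 : ℤ) < m ^ 2 := by positivity
    exact_mod_cast this
  have hden : (1 : ℝ) ≤ (r.den : ℝ) := by exact_mod_cast r.den_pos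
  have hden2 : (2 : ℝ) * (r.den : ℝ) ^ 2 ≤ 2 * (q : ℝ) ^ 2 := by
    rw [hm2]; push_cast; nlinarith [sq_nonneg (r.den : ℝ)]
  obtain ⟨k, hk⟩ := Real.exists_rat_eq_convergent (ξ := α) (q := r)
    (hdist.trans_le (one_div_le_one_div_of_le (by positivity) hden2))
  have hkN : N + 1 ≤ k := by
    by_contra h0
    exact hN1 k (by omega) (by rw [hk])
  obtain ⟨k, rfl⟩ : ∃ k', k = k' + 1 := ⟨k - 1, by omega⟩
  have hrat : (r.num / (r.den : ℤ) : ℚ) = r := by push_cast; exact Rat.num_div_den _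
  have e := approximation_convergent hS hα k _ _ (isCoprime_num_den r)
    (by exact_mod_cast r.den_ne_zero) (hrat.trans hk)
  have e2 : (r.num : ℝ) / ((r.den : ℤ) : ℝ) = (r : ℝ) := by
    exact_mod_cast congrArg (Rat.cast : ℚ → ℝ) hrat
  rw [e2] at e
  -- A common factor m of p and q divides the quotient by m², so passing to lowest terms costs
  -- nothing.
  have e3 := approximation_scale α ((r.den : ℤ) : ℝ) (r.num : ℝ) (m : ℝ)
  have hqR : (q : ℝ) = m * ((r.den : ℤ) : ℝ) := by exact_mod_cast hm2
  have hpR : (p : ℝ) = m * (r.num : ℝ) := by exact_mod_cast hm1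
  rw [← hqR, ← hpR, e] at e3
  rw [e3] at hcon
  have h5 : lam S (k + 2) ≤ c := by
    have := hN (k + 2) (by omega)
    simpa using this
  have h6 : |distortion S a r| * lam S (k + 2) ≤ |distortion S a r| * c :=
    mul_le_mul_of_nonneg_left h5 (abs_nonneg _)
  have h7 : 1 / (m : ℝ) ^ 2 ≤ 1 := by rw [div_le_one (by positivity)]; exact hm3
  have h8 : 0 ≤ |distortion S a r| * lam S (k + 2) :=
    mul_nonneg (abs_nonneg _) (lam_pos hS _).le
  nlinarith

end MarkovLagrange

end

noncomputable section

namespace MarkovLagrange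

/-! ### Sequences of ones and twos -/

variable {T : ℤ → ℕ}

/-- All letters are `1` or `2`. -/
def Dig (T : ℤ → ℕ) : Prop := ∀ i, T i = 1 ∨ T i = 2

lemma Dig.bpos (h : Dig T) : BPos T := fun i => by rcases h i with h | h <;> omega

lemma Dig.reflect (h : Dig T) : Dig (reflect T) := fun i => h (-i)

lemma Dig.translate (h : Dig T) (n : ℤ) : Dig (translate T n) := fun i => h (n + i)

/-- Letters at most 2 give tails below 3, hence the lower bound 1 + 1/3, and then the upper bound 2
+ 3/4. These are the initial values of `encl`. -/
lemma Dig.fwd_bounds (h : Dig T) (n : ℤ) : 4 / 3 ≤ fwd T n ∧ fwd T n ≤ 11 / 4 := by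
  have hd : ∀ m, (1 : ℝ) ≤ T m ∧ (T m : ℝ) ≤ 2 := fun m => by
    rcases h m with h | h <;> rw [h] <;> norm_num
  have h1 : ∀ m, 4 / 3 ≤ fwd T m := fun m => by
    have h2 := one_lt_fwd h.bpos (m + 1)
    have h3 : fwd T (m + 1) < T (m + 1) + 1 := by
      simpa [fwd] using cfValue_lt (a := fun k : ℕ => T (m + 1 + k)) fun k => h.bpos _
    have h4 : 1 / 3 ≤ 1 / fwd T (m + 1) :=
      one_div_le_one_div_of_le (by linarith) (by linarith [hd (m + 1)])
    rw [fwd_eq h.bpos]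
    linarith [hd m]
  refine ⟨h1 n, ?_⟩
  have h5 : 1 / fwd T (n + 1) ≤ 1 / (4 / 3) := one_div_le_one_div_of_le (by norm_num) (h1 _)
  rw [fwd_eq h.bpos]
  linarith [hd n]

/-- `T n, T (n+1), …` begins with the given word. -/
def ReadsR (T : ℤ → ℕ) : ℤ → List ℕ → Prop
  | _, [] => True
  | n, a :: l => T n = a ∧ ReadsR T (n + 1) l

/-- `T n, T (n-1), …` begins with the given word. -/
def ReadsL (T : ℤ → ℕ) : ℤ → List ℕ → Prop
  | _, [] => True
  | n, a :: l => T n = a ∧ ReadsL T (n - 1) l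

lemma readsR_iff (n : ℤ) (l : List ℕ) :
    ReadsR T n l ↔ ∀ (i : ℕ) (h : i < l.length), T (n + i) = l[i] := by
  induction l generalizing n with
  | nil => simp [ReadsR]
  | cons a l ih =>
    rw [ReadsR, ih]
    constructor
    · rintro ⟨h1, h2⟩ i hi
      cases i with
      | zero => simpa using h1
      | succ i =>
        have := h2 i (by simpa using hi)
        rw [List.getElem_cons_succ, ← this]
        congr 1; push_cast; ring
    · intro h
      have h0 := h 0 (by simp)
      rw [Nat.cast_zero, add_zero] at h0
      refine ⟨h0, fun i hi => ?_⟩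
      have := h (i + 1) (by simpa using hi)
      rw [List.getElem_cons_succ] at this
      rw [← this]
      congr 1; push_cast; ring

lemma readsR_reflect (n : ℤ) (l : List ℕ) : ReadsR (reflect T) n l ↔ ReadsL T (-n) l := by
  induction l generalizing n with
  | nil => simp [ReadsR, ReadsL]
  | cons a l ih => rw [ReadsR, ReadsL, ih, reflect, show -(n + 1) = -n - 1 by ring]

lemma readsL_iff (n : ℤ) (l : List ℕ) :
    ReadsL T n l ↔ ∀ (i : ℕ) (h : i < l.length), T (n - i) = l[i] := by
  have := readsR_iff (T := reflect T) (-n) l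
  rw [readsR_reflect, neg_neg] at this
  rw [this]
  simp only [reflect, neg_add_rev, neg_neg]
  refine forall₂_congr fun i hi => ?_
  rw [show -(i : ℤ) + n = n - i by ring]

lemma ReadsR.reverse {n : ℤ} {l : List ℕ} (h : ReadsR T n l) {m : ℤ} (hm : m = n + l.length - 1) :
    ReadsL T m l.reverse := by
  rw [readsL_iff]
  intro i hi
  rw [List.length_reverse] at hi
  rw [List.getElem_reverse, ← (readsR_iff n l).1 h _ (by omega)]
  congr 1
  omega

lemma ReadsL.reverse {n : ℤ} {l : List ℕ} (h : ReadsL T n l) {m : ℤ} (hm : m = n - l.length + 1) :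
    ReadsR T m l.reverse := by
  rw [readsR_iff]
  intro i hi
  rw [List.length_reverse] at hi
  rw [List.getElem_reverse, ← (readsL_iff n l).1 h _ (by omega)]
  congr 1
  omega

lemma readsR_append (n : ℤ) (l l' : List ℕ) :
    ReadsR T n (l ++ l') ↔ ReadsR T n l ∧ ReadsR T (n + l.length) l' := by
  induction l generalizing n with
  | nil => simp [ReadsR]
  | cons a l ih =>
    rw [List.cons_append, ReadsR, ReadsR, ih, and_assoc, List.length_cons]
    push_cast
    rw [show n + 1 + (l.length : ℤ) = n + (l.length + 1) by ring]

lemma readsL_append (n : ℤ) (l l' : List ℕ) :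
    ReadsL T n (l ++ l') ↔ ReadsL T n l ∧ ReadsL T (n - l.length) l' := by
  have := readsR_append (T := reflect T) (-n) l l'
  rw [readsR_reflect, readsR_reflect, readsR_reflect, neg_neg] at this
  rw [this, show -(-n + (l.length : ℤ)) = n - l.length by ring]

/-- The word `T n ⋯ T (n+k-1)`. -/
def factor (T : ℤ → ℕ) : ℤ → ℕ → List ℕ
  | _, 0 => []
  | n, k + 1 => T n :: factor T (n + 1) k

lemma length_factor (n : ℤ) (k : ℕ) : (factor T n k).length = k := by
  induction k generalizing n with
  | zero => rfl
  | succ k ih => rw [factor, List.length_cons, ih]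

lemma readsR_factor (n : ℤ) (k : ℕ) : ReadsR T n (factor T n k) := by
  induction k generalizing n with
  | zero => trivial
  | succ k ih => exact ⟨rfl, ih _⟩

lemma factor_congr {T' : ℤ → ℕ} (n m : ℤ) (k : ℕ) (h : ∀ i : ℕ, i < k → T (n + i) = T' (m + i)) :
    factor T n k = factor T' m k := by
  induction k generalizing n m with
  | zero => rfl
  | succ k ih =>
    rw [factor, factor]
    congr 1
    · simpa using h 0 (by omega)
    · refine ih _ _ fun i hi => ?_
      have := h (i + 1) (by omega)
      push_cast at this
      rw [show n + 1 + (i : ℤ) = n + (i + 1) by ring, this]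
      congr 1; ring

lemma ReadsR.congr {T' : ℤ → ℕ} {n m : ℤ} {l : List ℕ} (hl : ReadsR T n l)
    (h : ∀ i : ℕ, i < l.length → T (n + i) = T' (m + i)) : ReadsR T' m l := by
  rw [readsR_iff] at hl ⊢
  intro i hi
  rw [← h i hi, hl i hi]

/-! ### Rational enclosures -/

/-- `(a, b, c, d)` such that `a / b ≤ x ≤ c / d` for every `x = [l, x']` with
`4 / 3 ≤ x' ≤ 11 / 4`. -/
def encl : List ℕ → ℕ × ℕ × ℕ × ℕ
  | [] => (4, 3, 11, 4)
  | a :: l => match encl l with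
    | (p, q, r, s) => (a * r + s, r, a * p + q, p)

lemma encl_pos (l : List ℕ) :
    0 < (encl l).1 ∧ 0 < (encl l).2.1 ∧ 0 < (encl l).2.2.1 ∧ 0 < (encl l).2.2.2 := by
  induction l with
  | nil => simp [encl]
  | cons a l ih =>
    obtain ⟨h1, h2, h3, h4⟩ := ih
    exact ⟨Nat.add_pos_right _ h4, h3, Nat.add_pos_right _ h2, h1⟩

lemma fwd_mem_encl (hT : Dig T) {n : ℤ} {l : List ℕ} (hl : ReadsR T n l) :
    ((encl l).1 : ℝ) / (encl l).2.1 ≤ fwd T n ∧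
      fwd T n ≤ ((encl l).2.2.1 : ℝ) / (encl l).2.2.2 := by
  induction l generalizing n with
  | nil =>
    have := hT.fwd_bounds n
    simpa [encl] using this
  | cons a l ih =>
    obtain ⟨h1, h2⟩ := ih hl.2
    obtain ⟨p1, p2, p3, p4⟩ := encl_pos l
    have p1' : (0 : ℝ) < (encl l).1 := by exact_mod_cast p1
    have p2' : (0 : ℝ) < (encl l).2.1 := by exact_mod_cast p2
    have p3' : (0 : ℝ) < (encl l).2.2.1 := by exact_mod_cast p3
    have p4' : (0 : ℝ) < (encl l).2.2.2 := by exact_mod_cast p4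
    have h3 := one_lt_fwd hT.bpos (n + 1)
    rw [fwd_eq hT.bpos, hl.1]
    simp only [encl]
    push_cast
    have h4 := one_div_le_one_div_of_le (by positivity) h1
    have h5 := one_div_le_one_div_of_le (by linarith) h2
    rw [one_div_div] at h4 h5
    rw [add_div, add_div, mul_div_cancel_right₀ _ p3'.ne', mul_div_cancel_right₀ _ p1'.ne']
    constructor <;> linarith

lemma bwd_mem_encl (hT : Dig T) {n : ℤ} {l : List ℕ} (hl : ReadsL T n l) :
    ((encl l).1 : ℝ) / (encl l).2.1 ≤ bwd T n ∧
      bwd T n ≤ ((encl l).2.2.1 : ℝ) / (encl l).2.2.2 := by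
  have := fwd_mem_encl hT.reflect (n := -n) (l := l) (by rw [readsR_reflect, neg_neg]; exact hl)
  rwa [fwd_reflect, neg_neg] at this

/-- `x / y ≤ lam` whenever the right half is `R` and the left half is `L`. -/
def lamGe (x y : ℕ) (L R : List ℕ) : Bool :=
  match encl L, encl R with
  | (_, _, r, s), (p, q, _, _) => Nat.ble (x * (q * r)) (y * (p * r + s * q))

/-- `lam ≤ x / y` whenever the right half is `R` and the left half is `L`. -/
def lamLe (x y : ℕ) (L R : List ℕ) : Bool :=
  match encl L, encl R with
  | (p, q, _, _), (_, _, r, s) => Nat.ble (y * (r * p + q * s)) (x * (s * p))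

lemma le_lam_of_lamGe (hT : Dig T) {n : ℤ} {L R : List ℕ} (hL : ReadsL T (n - 1) L)
    (hR : ReadsR T n R) {x y : ℕ} (hy : 0 < y) (h : lamGe x y L R = true) :
    (x : ℝ) / y ≤ lam T n := by
  have h1 := (fwd_mem_encl hT hR).1
  have h2 := (bwd_mem_encl hT hL).2
  have h0 := one_lt_bwd hT.bpos (n - 1)
  obtain ⟨-, p2, -, -⟩ := encl_pos R
  obtain ⟨-, -, p3, p4⟩ := encl_pos L
  have h3 : x * ((encl R).2.1 * (encl L).2.2.1) ≤
      y * ((encl R).1 * (encl L).2.2.1 + (encl L).2.2.2 * (encl R).2.1) := Nat.le_of_ble_eq_true h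
  have h3' : (x : ℝ) * ((encl R).2.1 * (encl L).2.2.1) ≤
      y * ((encl R).1 * (encl L).2.2.1 + (encl L).2.2.2 * (encl R).2.1) := by exact_mod_cast h3
  have p2' : (0 : ℝ) < (encl R).2.1 := by exact_mod_cast p2
  have p3' : (0 : ℝ) < (encl L).2.2.1 := by exact_mod_cast p3
  have p4' : (0 : ℝ) < (encl L).2.2.2 := by exact_mod_cast p4
  have hy' : (0 : ℝ) < y := by exact_mod_cast hy
  have h5 := one_div_le_one_div_of_le (by linarith) h2
  rw [one_div_div] at h5
  have h6 : (x : ℝ) / y ≤ (encl R).1 / (encl R).2.1 + (encl L).2.2.2 / (encl L).2.2.1 := by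
    rw [div_add_div _ _ p2'.ne' p3'.ne', div_le_div_iff₀ hy' (by positivity)]
    linarith
  rw [lam]
  linarith

lemma lam_le_of_lamLe (hT : Dig T) {n : ℤ} {L R : List ℕ} (hL : ReadsL T (n - 1) L)
    (hR : ReadsR T n R) {x y : ℕ} (hy : 0 < y) (h : lamLe x y L R = true) :
    lam T n ≤ (x : ℝ) / y := by
  have h1 := (fwd_mem_encl hT hR).2
  have h2 := (bwd_mem_encl hT hL).1
  have h0 := one_lt_bwd hT.bpos (n - 1)
  obtain ⟨-, -, -, p2⟩ := encl_pos R
  obtain ⟨p3, p4, -, -⟩ := encl_pos L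
  have h3 : y * ((encl R).2.2.1 * (encl L).1 + (encl L).2.1 * (encl R).2.2.2) ≤
      x * ((encl R).2.2.2 * (encl L).1) := Nat.le_of_ble_eq_true h
  have h3' : (y : ℝ) * ((encl R).2.2.1 * (encl L).1 + (encl L).2.1 * (encl R).2.2.2) ≤
      x * ((encl R).2.2.2 * (encl L).1) := by exact_mod_cast h3
  have p2' : (0 : ℝ) < (encl R).2.2.2 := by exact_mod_cast p2
  have p3' : (0 : ℝ) < (encl L).1 := by exact_mod_cast p3
  have p4' : (0 : ℝ) < (encl L).2.1 := by exact_mod_cast p4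
  have hy' : (0 : ℝ) < y := by exact_mod_cast hy
  have h5 := one_div_le_one_div_of_le (by positivity) h2
  rw [one_div_div] at h5
  have h6 : (encl R).2.2.1 / (encl R).2.2.2 + (encl L).2.1 / (encl L).1 ≤ (x : ℝ) / y := by
    rw [div_add_div _ _ p2'.ne' p3'.ne', div_le_div_iff₀ (by positivity) hy']
    linarith
  rw [lam]
  linarith

/-! ### Forbidden words and tree search -/

/-- Sequences of `1` and `2` on which `lam` stays below a threshold slightly above `BInf`. -/
def Adm (T : ℤ → ℕ) : Prop := Dig T ∧ ∀ i, lam T i < 32930444815 / 10000000000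

lemma Adm.translate (h : Adm T) (n : ℤ) : Adm (translate T n) :=
  ⟨h.1.translate n, fun i => by rw [lam_translate]; exact h.2 _⟩

lemma Adm.reflect (h : Adm T) : Adm (reflect T) :=
  ⟨h.1.reflect, fun i => by rw [lam_reflect h.1.bpos]; exact h.2 _⟩

/-- Some position in `R`, preceded by `L`, has a value of `lam` above the threshold. -/
def deadFrom : List ℕ → List ℕ → Bool
  | _, [] => false
  | L, c :: R => lamGe 32930444815 10000000000 L (c :: R) || deadFrom (c :: L) R

lemma Adm.not_deadFrom (hT : Adm T) {n : ℤ} {L R : List ℕ} (hL : ReadsL T (n - 1) L)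
    (hR : ReadsR T n R) : deadFrom L R = false := by
  induction R generalizing n L with
  | nil => rfl
  | cons c R ih =>
    rw [deadFrom, Bool.or_eq_false_iff]
    constructor
    · by_contra h
      have := le_lam_of_lamGe hT.1 hL hR (by norm_num) (Bool.not_eq_false _ ▸ h)
      have h2 := hT.2 n
      norm_num at this
      linarith
    · refine ih (n := n + 1) ?_ hR.2
      rw [add_sub_cancel_right]
      exact ⟨hR.1, hL⟩

/-- A word which occurs in no admissible sequence. -/
def dead (l : List ℕ) : Bool := deadFrom [] l

lemma Adm.not_dead (hT : Adm T) {n : ℤ} {l : List ℕ} (hl : ReadsR T n l) : dead l ≠ true := by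
  rw [dead, hT.not_deadFrom (L := []) trivial hl]
  simp

/-- Exhaustive search among the admissible extensions of a pair of half-words; `good` recognizes
the leaves, `prune` discards further pairs and `side` selects the half to be extended. -/
def search (good prune side : List ℕ → List ℕ → Bool) : ℕ → List ℕ → List ℕ → Bool
  | 0, _, _ => false
  | k + 1, L, R => good L R || prune L R || dead (L.reverse ++ R) ||
      bif side L R then
        search good prune side k (L ++ [1]) R && search good prune side k (L ++ [2]) R
      else search good prune side k L (R ++ [1]) && search good prune side k L (R ++ [2])

/-- Soundness of the search: T follows one branch of the tree, and neither a dead word nor a pruned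
pair can occur along it, so the branch ends at a good leaf. -/
lemma Adm.exists_of_search (hT : Adm T) {n : ℤ} {good prune side : List ℕ → List ℕ → Bool}
    (hprune : ∀ L R, ReadsL T (n - 1) L → ReadsR T n R → prune L R = false) {k : ℕ}
    {L R : List ℕ} (hL : ReadsL T (n - 1) L) (hR : ReadsR T n R)
    (h : search good prune side k L R = true) :
    ∃ L' R', good L' R' = true ∧ ReadsL T (n - 1) L' ∧ ReadsR T n R' := by
  induction k generalizing L R with
  | zero => simp [search] at h
  | succ k ih =>
    have hd : dead (L.reverse ++ R) = false := by
      have h1 := hL.reverse (m := n - L.length) (by ring)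
      have h2 : ReadsR T (n - L.length) (L.reverse ++ R) := by
        rw [readsR_append]
        refine ⟨h1, ?_⟩
        rw [List.length_reverse, sub_add_cancel]
        exact hR
      exact Bool.eq_false_iff.2 (hT.not_dead h2)
    rw [search, hd, hprune L R hL hR, Bool.or_false, Bool.or_false, Bool.or_eq_true] at h
    rcases h with h | h
    · exact ⟨L, R, h, hL, hR⟩
    · cases hs : side L R
      · rw [hs, cond_false, Bool.and_eq_true] at h
        have hx : ∀ x, T (n + R.length) = x → ReadsR T n (R ++ [x]) := fun x hx => by
          rw [readsR_append]; exact ⟨hR, hx, trivial⟩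
        rcases hT.1 (n + R.length) with h1 | h1
        · exact ih hL (hx _ h1) h.1
        · exact ih hL (hx _ h1) h.2
      · rw [hs, cond_true, Bool.and_eq_true] at h
        have hx : ∀ x, T (n - 1 - L.length) = x → ReadsL T (n - 1) (L ++ [x]) := fun x hx => by
          rw [readsL_append]; exact ⟨hL, hx, trivial⟩
        rcases hT.1 (n - 1 - L.length) with h1 | h1
        · exact ih (hx _ h1) hR h.1
        · exact ih (hx _ h1) hR h.2

/-! ### Local uniqueness and self-replication -/

/-- The word `www`. -/
def w3 : List ℕ := w ++ w ++ w

/-- The word `wwww`. -/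
def w4 : List ℕ := w ++ w ++ w ++ w

lemma search_center : search
    (fun L R => (L == (w3.take 10).reverse && R == w3.drop 10) ||
      (L == w3.drop 11 && R == (w3.take 11).reverse))
    (fun L R => lamLe 3293044243 1000000000 L R)
    (fun L R => Nat.blt (L.length + 1) R.length) 25 [] [] = true := by
  decide +kernel

/-- The word is extended to the right until w is completed, but as soon as the next letter is 1 the
search turns to the left, where the only survivor is a fourth w. -/
lemma search_replicate : search
    (fun L R => R == w || (L == w4.reverse && R == [1]))
    (fun _ _ => false) (fun _ R => R.head? == some 1) 25 w3.reverse [] = true := by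
  decide +kernel

/-- Local uniqueness: around a large value of `lam` one reads `www` in one of the two directions. -/
lemma Adm.reads_w3 (hT : Adm T) {n : ℤ} (h : 3293044243 / 1000000000 < lam T n) :
    ReadsR T (n - 10) w3 ∨ ReadsL T (n + 10) w3 := by
  obtain ⟨L, R, hg, hL, hR⟩ := hT.exists_of_search (n := n) (L := []) (R := []) (by
    intro L R hL hR
    rw [Bool.eq_false_iff]
    intro hp
    have := lam_le_of_lamLe hT.1 hL hR (by norm_num) hp
    norm_num at this h
    linarith) trivial trivial search_center
  simp only [Bool.or_eq_true, Bool.and_eq_true, beq_iff_eq] at hg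
  rcases hg with ⟨rfl, rfl⟩ | ⟨rfl, rfl⟩
  · left
    rw [← List.take_append_drop 10 w3, readsR_append]
    have := hL.reverse (m := n - 10) (by simp [w3, w]; ring)
    rw [List.reverse_reverse] at this
    refine ⟨this, ?_⟩
    convert! hR using 1
    simp [w3, w]
  · right
    rw [← List.take_append_drop 11 w3, readsL_append]
    have := hR.reverse (m := n + 10) (by simp [w3, w]; ring)
    rw [List.reverse_reverse] at this
    refine ⟨this, ?_⟩
    convert! hL using 1
    simp [w3, w]
    ring

/-- Self-replication: `www` is followed by `w` unless `wwww` is followed by `1`. -/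
lemma Adm.replicate (hT : Adm T) {n : ℤ} (h : ReadsR T n w3) :
    ReadsR T (n + 21) w ∨ (ReadsR T (n - 7) w4 ∧ T (n + 21) = 1) := by
  obtain ⟨L, R, hg, hL, hR⟩ := hT.exists_of_search (n := n + 21) (L := w3.reverse) (R := [])
    (fun _ _ _ _ => rfl) (h.reverse (by simp [w3, w])) trivial search_replicate
  simp only [Bool.or_eq_true, Bool.and_eq_true, beq_iff_eq] at hg
  rcases hg with rfl | ⟨rfl, rfl⟩
  · exact Or.inl hR
  · right
    have := hL.reverse (m := n - 7) (by simp [w4, w]; ring)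
    rw [List.reverse_reverse] at this
    exact ⟨this, hR.1⟩

end MarkovLagrange

end

noncomputable section

namespace MarkovLagrange

/-! ### The three extremal sequences -/

lemma biSeq_add_period (u v r : List ℕ) (k : ℕ) (n : ℤ) (h : (v.length : ℤ) ≤ n + k) :
    biSeq u v r k (n + r.length) = biSeq u v r k n := by
  have h1 : ¬ (n + r.length + k < 0) := by omega
  have h2 : ¬ (n + r.length + k < v.length) := by omega
  have h3 : ¬ (n + k < 0) := by omega
  have h4 : ¬ (n + k < v.length) := by omega
  rw [biSeq, biSeq, if_neg h1, if_neg h2, if_neg h3, if_neg h4,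
    show n + (r.length : ℤ) + k - v.length = (n + k - v.length) + r.length by ring,
    Int.add_emod_right]

lemma biSeq_sub_period (u v r : List ℕ) (k : ℕ) (n : ℤ) (h : n + k < 0) :
    biSeq u v r k (n - u.length) = biSeq u v r k n := by
  have h1 : n - u.length + k < 0 := by omega
  rw [biSeq, biSeq, if_pos h1, if_pos h, show n - (u.length : ℤ) + k = n + k - u.length by ring,
    Int.sub_emod_right]

lemma dig_biSeq {u v r : List ℕ} {k : ℕ} (hu : ∀ x ∈ u, x = 1 ∨ x = 2) (hv : ∀ x ∈ v, x = 1 ∨ x = 2)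
    (hr : ∀ x ∈ r, x = 1 ∨ x = 2) (hu' : 0 < u.length) (hr' : 0 < r.length) :
    Dig (biSeq u v r k) := by
  intro n
  have key : ∀ l : List ℕ, (∀ x ∈ l, x = 1 ∨ x = 2) → ∀ i, i < l.length →
      l.getD i 0 = 1 ∨ l.getD i 0 = 2 := fun l hl i hi => by
    rw [List.getD_eq_getElem _ _ hi]; exact hl _ (List.getElem_mem hi)
  rw [biSeq]
  split_ifs with h1 h2
  · refine key u hu _ ?_
    have := Int.emod_lt_of_pos (n + k) (by omega : (0 : ℤ) < u.length)
    have := Int.emod_nonneg (n + k) (by omega : (u.length : ℤ) ≠ 0)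
    omega
  · exact key v hv _ (by omega)
  · refine key r hr _ ?_
    have := Int.emod_lt_of_pos (n + k - v.length) (by omega : (0 : ℤ) < r.length)
    have := Int.emod_nonneg (n + k - v.length) (by omega : (r.length : ℤ) ≠ 0)
    omega

/-- The sequence of `bInf`. -/
def bSeq : ℤ → ℕ := biSeq w w w 3

/-- The sequence of `BInf`. -/
def BSeq : ℤ → ℕ := biSeq [2, 1, 1, 2, 1, 1, 2, 1, 2, 2, 2, 1] (w ++ w ++ w ++ w)
    [1, 1, 2, 1, 2, 2, 2, 1, 2, 1, 1, 2] 17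

/-- The sequence of `mOne`. -/
def mSeq : ℤ → ℕ := biSeq [2, 2, 1, 2, 1, 1] (w ++ w) w 10

lemma dig_bSeq : Dig bSeq := dig_biSeq (by decide) (by decide) (by decide) (by decide) (by decide)

lemma dig_BSeq : Dig BSeq := dig_biSeq (by decide) (by decide) (by decide) (by decide) (by decide)

lemma dig_mSeq : Dig mSeq := dig_biSeq (by decide) (by decide) (by decide) (by decide) (by decide)

lemma bInf_eq : bInf = lam bSeq 0 := lambdaZero_eq dig_bSeq.bpos

lemma BInf_eq : BInf = lam BSeq 0 := lambdaZero_eq dig_BSeq.bpos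

lemma mOne_eq : mOne = lam mSeq 0 := lambdaZero_eq dig_mSeq.bpos

lemma BSeq_add (n : ℤ) (h : 11 ≤ n) : BSeq (n + 12) = BSeq n :=
  biSeq_add_period _ _ _ 17 n (by simp [w]; omega)

lemma BSeq_sub (n : ℤ) (h : n < -17) : BSeq (n - 12) = BSeq n :=
  biSeq_sub_period _ _ _ 17 n (by push_cast; omega)

lemma mSeq_add (n : ℤ) (h : 4 ≤ n) : mSeq (n + 7) = mSeq n :=
  biSeq_add_period _ _ _ 10 n (by simp [w]; omega)

lemma mSeq_sub (n : ℤ) (h : n < -10) : mSeq (n - 6) = mSeq n :=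
  biSeq_sub_period _ _ _ 10 n (by push_cast; omega)

lemma bSeq_add (n : ℤ) : bSeq (n + 7) = bSeq n := by
  by_cases h : 4 ≤ n
  · exact biSeq_add_period _ _ _ 3 n (by simp [w]; omega)
  · by_cases h' : n + 7 < -3
    · have := biSeq_sub_period w w w 3 (n + 7) (by push_cast; omega)
      rw [bSeq, ← this]; congr 1; simp [w]
    · have : ∀ m ∈ Finset.Icc (-10 : ℤ) 3, bSeq (m + 7) = bSeq m := by decide +kernel
      exact this n (Finset.mem_Icc.2 ⟨by omega, by omega⟩)

/-- A property of integers that is invariant by translation far away holds everywhere as soon as it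
holds on an interval. -/
lemma forall_of_window {P : ℤ → Prop} (a b p q : ℤ) (hp : 0 < p) (hq : 0 < q) (hbp : a ≤ b - p)
    (h : ∀ i, a ≤ i → i < b → P i) (hr : ∀ i, b ≤ i → P (i - p) → P i)
    (hl : ∀ i, i < a → P (i + q) → P i) (i : ℤ) : P i := by
  have h1 : ∀ n : ℕ, ∀ i, a ≤ i → i < b + n → P i := by
    intro n
    induction n with
    | zero => intro i h1 h2; exact h i h1 (by simpa using h2)
    | succ n ih =>
      intro i h1 h2
      by_cases h3 : i < b
      · exact h i h1 h3
      · exact hr i (by omega) (ih _ (by omega) (by push_cast at h2; omega))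
  have h2 : ∀ n : ℕ, ∀ i, a - n ≤ i → P i := by
    intro n
    induction n with
    | zero => intro i hi; exact h1 (i - b + 1).toNat i (by simpa using hi) (by omega)
    | succ n ih =>
      intro i hi
      by_cases h3 : a ≤ i
      · exact ih i (by omega)
      · exact hl i (by omega) (ih _ (by push_cast at hi; omega))
  exact h2 (a - i).toNat i (by omega)

/-- The bound `lam T i ≤ x / y`, certified by the letters at distance at most `20`. -/
def boundAt (T : ℤ → ℕ) (x y : ℕ) (i : ℤ) : Bool :=
  lamLe x y (factor T (i - 20) 20).reverse (factor T i 20)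

lemma lam_le_of_boundAt {T : ℤ → ℕ} (hT : Dig T) {x y : ℕ} (hy : 0 < y) {i : ℤ}
    (h : boundAt T x y i = true) : lam T i ≤ (x : ℝ) / y :=
  lam_le_of_lamLe hT ((readsR_factor _ _).reverse (by rw [length_factor]; push_cast; ring))
    (readsR_factor _ _) hy h

lemma boundAt_congr {T : ℤ → ℕ} (x y : ℕ) (i j : ℤ)
    (h : ∀ k : ℤ, -20 ≤ k → k < 20 → T (i + k) = T (j + k)) :
    boundAt T x y i = boundAt T x y j := by
  have e1 : factor T (i - 20) 20 = factor T (j - 20) 20 := factor_congr _ _ _ fun k hk => by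
    have := h (k - 20) (by omega) (by omega)
    rw [show i - 20 + (k : ℤ) = i + (k - 20) by ring, this]; congr 1; ring
  have e2 : factor T i 20 = factor T j 20 := factor_congr _ _ _ fun k hk => h _ (by omega) (by omega)
  rw [boundAt, boundAt, e1, e2]

lemma le_lam_factor {T : ℤ → ℕ} (hT : Dig T) {x y : ℕ} (hy : 0 < y) {i : ℤ}
    (h : lamGe x y (factor T (i - 20) 20).reverse (factor T i 20) = true) :
    (x : ℝ) / y ≤ lam T i :=
  le_lam_of_lamGe hT ((readsR_factor _ _).reverse (by rw [length_factor]; push_cast; ring))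
    (readsR_factor _ _) hy h

/-! ### Numerical enclosures, and maximality of `lam` at the origin. -/

lemma lt_bInf : 329304424390 / 100000000000 ≤ bInf := by
  rw [bInf_eq]
  have := le_lam_factor dig_bSeq (x := 329304424390) (y := 100000000000) (i := 0) (by norm_num)
    (by decide +kernel)
  norm_num at this ⊢; exact this

lemma bInf_lt : bInf ≤ 329304424396 / 100000000000 := by
  rw [bInf_eq]
  have := lam_le_of_boundAt dig_bSeq (x := 329304424396) (y := 100000000000) (i := 0) (by norm_num)
    (by decide +kernel)
  norm_num at this ⊢; exact this

lemma lt_BInf : 32930444814 / 10000000000 ≤ BInf := by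
  rw [BInf_eq]
  have := le_lam_factor dig_BSeq (x := 32930444814) (y := 10000000000) (i := 0) (by norm_num)
    (by decide +kernel)
  norm_num at this ⊢; exact this

lemma BInf_lt : BInf < 32930444815 / 10000000000 := by
  rw [BInf_eq]
  have := lam_le_of_boundAt dig_BSeq (x := 329304448145) (y := 100000000000) (i := 0) (by norm_num)
    (by decide +kernel)
  norm_num at this ⊢; linarith

lemma lt_mOne : 32930443903 / 10000000000 ≤ mOne := by
  rw [mOne_eq]
  have := le_lam_factor dig_mSeq (x := 32930443903) (y := 10000000000) (i := 0) (by norm_num)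
    (by decide +kernel)
  norm_num at this ⊢; exact this

lemma mOne_lt : mOne ≤ 32930443904 / 10000000000 := by
  rw [mOne_eq]
  have := lam_le_of_boundAt dig_mSeq (x := 32930443904) (y := 10000000000) (i := 0) (by norm_num)
    (by decide +kernel)
  norm_num at this ⊢; exact this

lemma lam_BSeq_le (i : ℤ) : lam BSeq i ≤ BInf := by
  have key : i = 0 ∨ boundAt BSeq 32930444814 10000000000 i = true := by
    -- Outside the window, all 40 letters inspected by `boundAt` remain in one periodic end after
    -- translation by 12 towards the centre, so finitely many positions suffice.
    refine forall_of_window (P := fun i => i = 0 ∨ boundAt BSeq 32930444814 10000000000 i = true)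
      (-50) 45 12 12 (by norm_num) (by norm_num) (by norm_num) ?_ ?_ ?_ i
    · have h : ∀ i ∈ Finset.Ico (-50 : ℤ) 45,
          i = 0 ∨ boundAt BSeq 32930444814 10000000000 i = true := by decide +kernel
      exact fun i h1 h2 => h i (Finset.mem_Ico.2 ⟨h1, h2⟩)
    · rintro i hi (h | h)
      · omega
      · right
        rw [← h]
        refine boundAt_congr _ _ _ _ fun k hk _ => ?_
        rw [← BSeq_add (i - 12 + k) (by omega)]; exact congrArg BSeq (by ring)
    · rintro i hi (h | h)
      · omega
      · right
        rw [← h]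
        refine boundAt_congr _ _ _ _ fun k _ hk => ?_
        rw [← BSeq_sub (i + 12 + k) (by omega)]; exact congrArg BSeq (by ring)
  rcases key with rfl | h
  · rw [BInf_eq]
  · have := lam_le_of_boundAt dig_BSeq (by norm_num) h
    refine le_trans ?_ lt_BInf
    norm_num at this ⊢; exact this

lemma lam_mSeq_le (i : ℤ) : lam mSeq i ≤ lam mSeq 0 := by
  have key : i = 0 ∨ boundAt mSeq 32930443903 10000000000 i = true := by
    refine forall_of_window (P := fun i => i = 0 ∨ boundAt mSeq 32930443903 10000000000 i = true)
      (-40) 35 7 6 (by norm_num) (by norm_num) (by norm_num) ?_ ?_ ?_ i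
    · have h : ∀ i ∈ Finset.Ico (-40 : ℤ) 35,
          i = 0 ∨ boundAt mSeq 32930443903 10000000000 i = true := by decide +kernel
      exact fun i h1 h2 => h i (Finset.mem_Ico.2 ⟨h1, h2⟩)
    · rintro i hi (h | h)
      · omega
      · right
        rw [← h]
        refine boundAt_congr _ _ _ _ fun k hk _ => ?_
        rw [← mSeq_add (i - 7 + k) (by omega)]; exact congrArg mSeq (by ring)
    · rintro i hi (h | h)
      · omega
      · right
        rw [← h]
        refine boundAt_congr _ _ _ _ fun k _ hk => ?_
        rw [← mSeq_sub (i + 6 + k) (by omega)]; exact congrArg mSeq (by ring)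
  rcases key with rfl | h
  · exact le_rfl
  · have := lam_le_of_boundAt dig_mSeq (by norm_num) h
    rw [← mOne_eq]
    refine le_trans ?_ lt_mOne
    norm_num at this ⊢; exact this

lemma bSeq_add_mul (m n : ℤ) : bSeq (n + 7 * m) = bSeq n := by
  have h : Function.Periodic bSeq 7 := bSeq_add
  have := h.int_mul m n
  rwa [mul_comm] at this

lemma lam_bSeq_add_mul (m n : ℤ) : lam bSeq (n + 7 * m) = lam bSeq n := by
  have : translate bSeq (7 * m) = bSeq := funext fun i => by
    rw [translate, add_comm]; exact bSeq_add_mul m i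
  rw [add_comm, ← lam_translate, this]

lemma lam_bSeq_le (i : ℤ) : lam bSeq i ≤ bInf := by
  rw [← Int.emod_add_mul_ediv i 7, lam_bSeq_add_mul]
  have h : ∀ i ∈ Finset.Ico (0 : ℤ) 7,
      i = 0 ∨ boundAt bSeq 32930442439 10000000000 i = true := by decide +kernel
  rcases h (i % 7) (Finset.mem_Ico.2 ⟨by omega, by omega⟩) with h | h
  · rw [h, bInf_eq]
  · have := lam_le_of_boundAt dig_bSeq (by norm_num) h
    refine le_trans ?_ lt_bInf
    norm_num at this ⊢; exact this

/-! ### Minimality of `BInf` -/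

/-- A smaller first difference with `BSeq` at the position `j` on the right is forbidden. -/
def checkRight (j : ℤ) : Bool :=
  (BSeq j == if j % 2 = 0 then 1 else 2) || dead (factor BSeq (j - 10) 10 ++ [3 - BSeq j])

/-- A smaller first difference with `BSeq` at the position `j` on the left is forbidden. -/
def checkLeft (j : ℤ) : Bool :=
  (BSeq j == if j % 2 = 0 then 1 else 2) || dead ((3 - BSeq j) :: factor BSeq (j + 1) 31)

lemma checkRight_eq_true (j : ℤ) (hj : 12 ≤ j) : checkRight j = true := by
  refine forall_of_window (P := fun j => 12 ≤ j → checkRight j = true) 0 40 12 12 (by norm_num)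
    (by norm_num) (by norm_num) ?_ ?_ ?_ j hj
  · have h : ∀ j ∈ Finset.Ico (12 : ℤ) 40, checkRight j = true := by decide +kernel
    exact fun j _ h2 h1 => h j (Finset.mem_Ico.2 ⟨h1, h2⟩)
  · intro j hj h _
    rw [← h (by omega), checkRight, checkRight]
    have e : BSeq j = BSeq (j - 12) := by rw [← BSeq_add (j - 12) (by omega)]; exact congrArg BSeq (by ring)
    rw [e, show (j - 12) % 2 = j % 2 by omega]
    congr 3
    refine factor_congr _ _ _ fun k hk => ?_
    rw [← BSeq_add (j - 12 - 10 + k) (by omega)]; exact congrArg BSeq (by ring)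
  · intro j h1 _ h2; omega

lemma checkLeft_eq_true (j : ℤ) (hj : j ≤ -20) : checkLeft j = true := by
  refine forall_of_window (P := fun j => j ≤ -20 → checkLeft j = true) (-70) 0 12 12 (by norm_num)
    (by norm_num) (by norm_num) ?_ ?_ ?_ j hj
  · have h : ∀ j ∈ Finset.Icc (-70 : ℤ) (-20), checkLeft j = true := by decide +kernel
    exact fun j h1 _ h2 => h j (Finset.mem_Icc.2 ⟨h1, h2⟩)
  · intro j h1 _ h2; omega
  · intro j hj h _
    rw [← h (by omega), checkLeft, checkLeft]
    have e : BSeq j = BSeq (j + 12) := by rw [← BSeq_sub (j + 12) (by omega)]; exact congrArg BSeq (by ring)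
    rw [e, show (j + 12) % 2 = j % 2 by omega]
    congr 3
    refine factor_congr _ _ _ fun k hk => ?_
    rw [← BSeq_sub (j + 12 + 1 + k) (by omega)]; exact congrArg BSeq (by ring)

lemma reads_BSeq : ReadsR BSeq (-17) (w4 ++ [1]) := by
  have : factor BSeq (-17) 29 = w4 ++ [1] := by decide +kernel
  rw [← this]; exact readsR_factor _ _

variable {T : ℤ → ℕ}

lemma Dig.three_sub (hT : Dig T) {j : ℤ} (h : T j ≠ BSeq j) : T j = 3 - BSeq j := by
  rcases hT j with h1 | h1 <;> rcases dig_BSeq j with h2 | h2 <;> omega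

lemma eq_BSeq_of_reads (h : ReadsR T (-17) (w4 ++ [1])) (i : ℤ) (h1 : -17 ≤ i) (h2 : i < 12) :
    T i = BSeq i := by
  have hi : (i + 17).toNat < (w4 ++ [1]).length := by
    have : (w4 ++ [1]).length = 29 := by decide
    rw [this]; omega
  have e1 := (readsR_iff _ _).1 h _ hi
  have e2 := (readsR_iff _ _).1 reads_BSeq _ hi
  rw [← e2] at e1
  rwa [show (-17 : ℤ) + (i + 17).toNat = i by omega] at e1

/-- At the first difference, `checkRight` leaves two options: the parity and the letter of `BSeq`
make T larger, or the 10 preceding letters followed by the new one form a forbidden word. -/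
lemma Adm.fwd_BSeq_le (hT : Adm T) (h : ReadsR T (-17) (w4 ++ [1])) : fwd BSeq 0 ≤ fwd T 0 := by
  by_cases hall : ∀ j : ℕ, T j = BSeq j
  · have : fwd T 0 = fwd BSeq 0 := by
      rw [fwd, fwd]; congr 1; ext k; rw [zero_add]; exact hall k
    rw [this]
  push Not at hall
  classical
  have hj := Nat.find_spec hall
  have hmin := fun i (hi : i < Nat.find hall) => not_not.1 (Nat.find_min hall hi)
  generalize Nat.find hall = j at hj hmin
  have h12 : 12 ≤ j := by
    by_contra hlt
    exact hj (eq_BSeq_of_reads h _ (by omega) (by omega))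
  have hTj := hT.1.three_sub hj
  have hc := checkRight_eq_true j (by exact_mod_cast h12)
  rw [checkRight, Bool.or_eq_true] at hc
  rcases hc with hc | hc
  · refine cfValue_le_of_first_diff (fun _ => dig_BSeq.bpos _) (fun _ => hT.1.bpos _) j
      (fun i hi => by rw [zero_add]; exact (hmin i hi).symm) ?_
    have hc' := beq_iff_eq.1 hc
    simp only [zero_add, hTj]
    by_cases he : Even j
    · have : (j : ℤ) % 2 = 0 := by have := Nat.even_iff.1 he; omega
      rw [if_pos this] at hc'
      rw [if_pos he]; omega
    · have : (j : ℤ) % 2 ≠ 0 := by rw [Nat.even_iff] at he; omega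
      rw [if_neg this] at hc'
      rw [if_neg he]; omega
  · refine absurd hc (hT.not_dead (n := j - 10) ?_)
    rw [readsR_append]
    refine ⟨(readsR_factor (T := BSeq) (j - 10) 10).congr fun i hi => ?_, ?_, trivial⟩
    · rw [length_factor] at hi
      by_cases h0 : (j : ℤ) - 10 + i < 0
      · exact (eq_BSeq_of_reads h _ (by omega) (by omega)).symm
      · have := hmin (j - 10 + i) (by omega)
        rw [show ((j - 10 + i : ℕ) : ℤ) = (j : ℤ) - 10 + i by omega] at this
        exact this.symm
    · rw [length_factor, ← hTj]; exact congrArg T (by push_cast; ring)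

/-- The backward value enters `lam` through its inverse, so minimality of `lam` requires an upper
bound here. -/
lemma Adm.bwd_le_BSeq (hT : Adm T) (h : ReadsR T (-17) (w4 ++ [1])) :
    bwd T (-1) ≤ bwd BSeq (-1) := by
  by_cases hall : ∀ j : ℕ, T (-1 - j) = BSeq (-1 - j)
  · have : bwd T (-1) = bwd BSeq (-1) := by
      rw [bwd, bwd]; congr 1; ext k; exact hall k
    rw [this]
  push Not at hall
  classical
  have hj := Nat.find_spec hall
  have hmin := fun i (hi : i < Nat.find hall) => not_not.1 (Nat.find_min hall hi)
  generalize Nat.find hall = j at hj hmin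
  have h17 : 17 ≤ j := by
    by_contra hlt
    exact hj (eq_BSeq_of_reads h _ (by omega) (by omega))
  have hTj := hT.1.three_sub hj
  have hgood : (BSeq (-1 - j) == if (-1 - (j : ℤ)) % 2 = 0 then 1 else 2) = true →
      bwd T (-1) ≤ bwd BSeq (-1) := by
    intro hc
    refine cfValue_le_of_first_diff (fun _ => hT.1.bpos _) (fun _ => dig_BSeq.bpos _) j
      (fun i hi => hmin i hi) ?_
    have hc' := beq_iff_eq.1 hc
    simp only [hTj]
    by_cases he : Even j
    · have : (-1 - (j : ℤ)) % 2 ≠ 0 := by have := Nat.even_iff.1 he; omega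
      rw [if_neg this] at hc'
      rw [if_pos he]; omega
    · have : (-1 - (j : ℤ)) % 2 = 0 := by rw [Nat.even_iff] at he; omega
      rw [if_pos this] at hc'
      rw [if_neg he]; omega
  -- The 31 letters of context to the right of position −1 − j must stay within the known letters,
  -- which end at position 11; this forces j ≥ 19. For j = 17 and j = 18 the parity alone decides.
  by_cases h19 : 19 ≤ j
  · have hc := checkLeft_eq_true (-1 - j) (by omega)
    rw [checkLeft, Bool.or_eq_true] at hc
    rcases hc with hc | hc
    · exact hgood hc
    · refine absurd hc (hT.not_dead (n := -1 - j) ⟨hTj, ?_⟩)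
      refine (readsR_factor (T := BSeq) (-1 - j + 1) 31).congr fun i hi => ?_
      rw [length_factor] at hi
      by_cases h0 : -1 - (j : ℤ) + 1 + i < 0
      · have := hmin (j - 1 - i) (by omega)
        rw [show -1 - ((j - 1 - i : ℕ) : ℤ) = -1 - (j : ℤ) + 1 + i by omega] at this
        exact this.symm
      · exact (eq_BSeq_of_reads h _ (by omega) (by omega)).symm
  · apply hgood
    obtain rfl | rfl : j = 17 ∨ j = 18 := by omega
    · decide +kernel
    · decide +kernel

/-- Minimality of `BInf` among the values of `lam` where self-replication breaks. -/
lemma Adm.BInf_le (hT : Adm T) {n : ℤ} (h : ReadsR T n w4) (h1 : T (n + 28) = 1) :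
    BInf ≤ lam T (n + 17) := by
  have hT' := hT.translate (n + 17)
  have hr : ReadsR (MarkovLagrange.translate T (n + 17)) (-17) (w4 ++ [1]) := by
    rw [readsR_append]
    constructor
    · exact h.congr fun i _ => by rw [MarkovLagrange.translate]; congr 1; ring
    · refine ⟨?_, trivial⟩
      rw [MarkovLagrange.translate, ← h1]
      congr 1
      simp [w4, w]; ring
  have e1 := hT'.fwd_BSeq_le hr
  have e2 := hT'.bwd_le_BSeq hr
  have e3 : lam T (n + 17) = lam (MarkovLagrange.translate T (n + 17)) 0 := by
    rw [lam_translate, add_zero]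
  rw [e3, BInf_eq, lam, lam, zero_sub]
  have := one_lt_bwd hT'.1.bpos (-1)
  have := one_div_le_one_div_of_le (by linarith) e2
  linarith

end MarkovLagrange

end

noncomputable section

namespace MarkovLagrange

/-! ### The gap -/

variable {S : ℤ → ℕ}

/-- Sequences that agree from some index on have nearly the same values of `lam` far away. -/
lemma eventually_abs_lam_sub_lt {T : ℤ → ℕ} (hS : BPos S) (hT : BPos T) {N s : ℤ}
    (h : ∀ n, N ≤ n → S n = T (n + s)) {ε : ℝ} (hε : 0 < ε) :
    ∃ K : ℤ, ∀ n, K ≤ n → |lam S n - lam T (n + s)| < ε := by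
  obtain ⟨k, hk⟩ := exists_pow_lt_of_lt_one (half_pos hε) (by norm_num : (1 / 4 : ℝ) < 1)
  refine ⟨N + 2 * k + 1, fun n hn => ?_⟩
  have := abs_lam_sub_le hS hT n (n + s) k fun i hi => by
    have := (abs_le.1 hi).1
    rw [h _ (by omega)]; congr 1; ring
  linarith

/-- Compactness: T is the limit of the shifts of S along an ultrafilter containing P and finer than
`atTop`. Every finite window of T occurs in S arbitrarily far to the right, centred at an index
satisfying P. -/
lemma exists_limit (hd : ∀ᶠ k : ℕ in atTop, S k = 1 ∨ S k = 2) {P : ℕ → Prop}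
    (hP : ∃ᶠ k in atTop, P k) :
    ∃ T : ℤ → ℕ, Dig T ∧ ∀ a N : ℕ, ∃ k ≥ N, P k ∧ ∀ i : ℤ, |i| ≤ a → S (k + i) = T i := by
  classical
  have hne : (atTop ⊓ 𝓟 {k | P k} : Filter ℕ).NeBot := frequently_mem_iff_neBot.1 hP
  set U := Ultrafilter.of (atTop ⊓ 𝓟 {k | P k} : Filter ℕ)
  have hU : (U : Filter ℕ) ≤ atTop ⊓ 𝓟 {k | P k} := Ultrafilter.of_le _
  have hU1 : (U : Filter ℕ) ≤ atTop := hU.trans inf_le_left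
  have hU2 : ∀ᶠ k in (U : Filter ℕ), P k := (hU.trans inf_le_right) (mem_principal_self _)
  have hdi : ∀ i : ℤ, ∀ᶠ k : ℕ in (U : Filter ℕ), S (k + i) = 1 ∨ S (k + i) = 2 := by
    intro i
    obtain ⟨N, hN⟩ := eventually_atTop.1 hd
    refine hU1 (eventually_atTop.2 ⟨N + i.natAbs, fun k hk => ?_⟩)
    have := hN (k + i).toNat (by omega)
    rwa [show ((k + i : ℤ).toNat : ℤ) = k + i by omega] at this
  refine ⟨fun i => if ∀ᶠ k : ℕ in (U : Filter ℕ), S (k + i) = 1 then 1 else 2, fun i => ?_, ?_⟩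
  · dsimp only
    split_ifs <;> simp
  · intro a N
    have hT : ∀ i : ℤ, ∀ᶠ k : ℕ in (U : Filter ℕ),
        S (k + i) = if ∀ᶠ k : ℕ in (U : Filter ℕ), S (k + i) = 1 then 1 else 2 := by
      intro i
      split_ifs with h
      · exact h
      · rw [← Ultrafilter.eventually_not] at h
        filter_upwards [h, hdi i] with k h1 h2
        exact h2.resolve_left h1
    have hall := (eventually_all_finset (Finset.Icc (-(a : ℤ)) a)).2 fun i _ => hT i
    obtain ⟨k, ⟨h1, h2⟩, h3⟩ := ((hU2.and hall).and (hU1 (eventually_ge_atTop N))).exists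
    exact ⟨k, h3, h1, fun i hi => h2 i (Finset.mem_Icc.2 (abs_le.1 hi))⟩

lemma lam_limit_le {T : ℤ → ℕ} (hS : BPos S) (hT : BPos T) {P : ℕ → Prop}
    (hlim : ∀ a N : ℕ, ∃ k ≥ N, P k ∧ ∀ i : ℤ, |i| ≤ a → S (k + i) = T i) {x : ℝ}
    (hx : ∀ c, x < c → ∃ N : ℤ, ∀ n, N ≤ n → lam S n < c) (i : ℤ) : lam T i ≤ x := by
  refine le_of_forall_pos_le_add fun ε hε => ?_
  obtain ⟨j, hj⟩ := exists_pow_lt_of_lt_one (by positivity : 0 < ε / 4)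
    (by norm_num : (1 / 4 : ℝ) < 1)
  obtain ⟨N, hN⟩ := hx (x + ε / 2) (by linarith)
  obtain ⟨k, hk, -, h⟩ := hlim (i.natAbs + 2 * j + 1) (N.natAbs + i.natAbs)
  have h1 := hN (k + i) (by omega)
  have h2 := abs_lam_sub_le hS hT (k + i) i j fun m hm => by
    rw [add_assoc]
    refine h (i + m) ?_
    push_cast
    exact (abs_add_le _ _).trans (by rw [Int.abs_eq_natAbs i]; linarith)
  have := (abs_le.1 h2).1
  linarith

lemma le_lam_limit {T : ℤ → ℕ} (hS : BPos S) (hT : BPos T) {c : ℝ}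
    (hlim : ∀ a N : ℕ, ∃ k ≥ N, c < lam S k ∧ ∀ i : ℤ, |i| ≤ a → S (k + i) = T i) :
    c ≤ lam T 0 := by
  refine le_of_forall_pos_le_add fun ε hε => ?_
  obtain ⟨j, hj⟩ := exists_pow_lt_of_lt_one (half_pos hε) (by norm_num : (1 / 4 : ℝ) < 1)
  obtain ⟨k, -, hk, h⟩ := hlim (2 * j + 1) 0
  have h2 := abs_lam_sub_le hS hT k 0 j fun m hm => by
    rw [zero_add]; exact h m (by push_cast; exact hm)
  have := (abs_le.1 h2).2
  linarith

/-- The bound 7/2 excludes letters ≥ 4. A letter 3 whose neighbours are at most 3 gives a value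
above 3 + 1/4 + 1/4; looking at the left neighbour costs one index. -/
lemma eventually_dig (hS : BPos S) {N : ℤ} (h : ∀ n, N ≤ n → lam S n < 7 / 2) (n : ℤ)
    (hn : N + 1 ≤ n) : S n = 1 ∨ S n = 2 := by
  have h3 : ∀ m, N ≤ m → S m ≤ 3 := fun m hm => by
    have h1 := lam_eq hS m
    have h2 := one_div_pos.2 (zero_lt_one.trans (one_lt_fwd hS (m + 1)))
    have h3 := one_div_pos.2 (zero_lt_one.trans (one_lt_bwd hS (m - 1)))
    have h4 : (S m : ℝ) < 4 := by linarith [h m hm]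
    have : S m < 4 := by exact_mod_cast h4
    omega
  have h0 := hS n
  by_contra hc
  have hn3 : S n = 3 := by have := h3 n (by omega); omega
  have h1 := lam_eq hS n
  have hf : fwd S (n + 1) ≤ 4 := by
    have e : fwd S (n + 1) < S (n + 1) + 1 := by
      simpa [fwd] using cfValue_lt (a := fun k : ℕ => S (n + 1 + k)) fun k => hS _
    have : (S (n + 1) : ℝ) ≤ 3 := by exact_mod_cast h3 (n + 1) (by omega)
    linarith
  have hb : bwd S (n - 1) ≤ 4 := by
    have e : bwd S (n - 1) < S (n - 1) + 1 := by
      simpa [bwd] using cfValue_lt (a := fun k : ℕ => S (n - 1 - k)) fun k => hS _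
    have : (S (n - 1) : ℝ) ≤ 3 := by exact_mod_cast h3 (n - 1) (by omega)
    linarith
  have h2 := one_div_le_one_div_of_le (zero_lt_one.trans (one_lt_fwd hS (n + 1))) hf
  have h4 := one_div_le_one_div_of_le (zero_lt_one.trans (one_lt_bwd hS (n - 1))) hb
  have h5 := h n (by omega)
  rw [hn3] at h1
  norm_num at h1 h2 h4
  linarith

/-! ### Replication and eventual periodicity. -/

lemma readsR_w3_of_reads {n : ℤ} (h : ReadsR S n w3) (h' : ReadsR S (n + 21) w) :
    ReadsR S (n + 7) w3 := by
  have h1 : ReadsR S n (w ++ (w ++ w)) := h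
  rw [readsR_append] at h1
  have h2 : ReadsR S (n + 7) ((w ++ w) ++ w) := by
    rw [readsR_append]
    refine ⟨h1.2, ?_⟩
    convert! h' using 1
    simp [w]; ring
  exact h2

lemma readsL_w3_of_reads {n : ℤ} (h : ReadsL S n w3) (h' : ReadsL S (n - 21) w) :
    ReadsL S (n - 7) w3 := by
  have := readsR_w3_of_reads (S := reflect S) (n := -n)
    (by rw [readsR_reflect, neg_neg]; exact h)
    (by rw [readsR_reflect]; convert! h' using 1; ring)
  rw [readsR_reflect] at this
  convert! this using 1
  ring

lemma reads_bSeq : ReadsR bSeq (-3) w3 := by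
  have : factor bSeq (-3) 21 = w3 := by decide +kernel
  rw [← this]; exact readsR_factor _ _

lemma eq_bSeq_of_readsR {n : ℤ} (h : ReadsR S n w3) (i : ℕ) (hi : i < 21) :
    S (n + i) = bSeq (i - 3) := by
  have hl : w3.length = 21 := by decide
  rw [(readsR_iff _ _).1 h i (by omega), ← (readsR_iff _ _).1 reads_bSeq i (by omega)]
  congr 1

lemma eq_bSeq_of_readsL {n : ℤ} (h : ReadsL S n w3) (i : ℕ) (hi : i < 21) :
    S (n - i) = bSeq (i - 3) := by
  have hl : w3.length = 21 := by decide
  rw [(readsL_iff _ _).1 h i (by omega), ← (readsR_iff _ _).1 reads_bSeq i (by omega)]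
  congr 1

/-- Forward replication makes a sequence eventually periodic. -/
lemma eq_bSeq_of_replicateR {N k : ℤ} (hrep : ∀ n, N ≤ n → ReadsR S n w3 → ReadsR S (n + 21) w)
    (hk : N ≤ k) (h : ReadsR S k w3) (n : ℤ) (hn : k ≤ n) : S n = bSeq (n + (-k - 3)) := by
  have h1 : ∀ m : ℕ, ReadsR S (k + 7 * m) w3 := by
    intro m
    induction m with
    | zero => simpa using h
    | succ m ih =>
      have := readsR_w3_of_reads ih (hrep _ (by omega) ih)
      convert! this using 1
      push_cast; ring
  obtain ⟨d, rfl⟩ : ∃ d : ℕ, n = k + d := ⟨(n - k).toNat, by omega⟩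
  have h2 := eq_bSeq_of_readsR (h1 (d / 7)) (d % 7) (by omega)
  rw [show (k + d : ℤ) = k + 7 * (d / 7 : ℕ) + (d % 7 : ℕ) by omega, h2,
    ← bSeq_add_mul (d / 7 : ℕ)]
  congr 1; ring

/-- Backward replication at arbitrarily large positions makes a sequence eventually periodic. -/
lemma eq_bSeq_of_replicateL {N : ℤ} (hrep : ∀ n, N ≤ n → ReadsL S n w3 → ReadsL S (n - 21) w)
    (hk : ∀ K, ∃ k, K ≤ k ∧ ReadsL S k w3) :
    ∃ k s : ℤ, ∀ n, k ≤ n → S n = reflect bSeq (n + s) := by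
  have h1 : ∀ k, ReadsL S k w3 → ∀ m : ℕ, N ≤ k - 7 * m → ReadsL S (k - 7 * m) w3 := by
    intro k h m
    induction m with
    | zero => intro _; simpa using h
    | succ m ih =>
      intro hm
      push_cast at hm
      have ih' := ih (by omega)
      have := readsL_w3_of_reads ih' (hrep _ (by omega) ih')
      convert! this using 1
      push_cast; ring
  -- From an occurrence beyond i + 7, replication descends to one whose 21 letters contain both i
  -- and i + 7. As occurrences exist arbitrarily far out, S has period 7 from N on.
  have hper : ∀ i, N ≤ i → S (i + 7) = S i := by
    intro i hi
    obtain ⟨k, hk1, hk2⟩ := hk (i + 7)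
    obtain ⟨d, rfl⟩ : ∃ d : ℕ, k = i + 7 + d := ⟨(k - (i + 7)).toNat, by omega⟩
    have h2 := h1 _ hk2 (d / 7) (by omega)
    have h3 := eq_bSeq_of_readsL h2 (d % 7) (by omega)
    have h4 := eq_bSeq_of_readsL h2 (d % 7 + 7) (by omega)
    rw [show i + 7 + (d : ℤ) - 7 * (d / 7 : ℕ) - (d % 7 : ℕ) = i + 7 by omega] at h3
    rw [show i + 7 + (d : ℤ) - 7 * (d / 7 : ℕ) - (d % 7 + 7 : ℕ) = i by omega] at h4
    rw [h3, h4, ← bSeq_add]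
    congr 1; push_cast; ring
  obtain ⟨k, hk1, hk2⟩ := hk (N + 7)
  refine ⟨k - 6, 3 - k, fun n hn => ?_⟩
  obtain ⟨d, rfl⟩ : ∃ d : ℕ, n = k - 6 + d := ⟨(n - (k - 6)).toNat, by omega⟩
  clear hn
  induction d using Nat.strong_induction_on with
  | _ d ih =>
    by_cases hd : d < 7
    · have := eq_bSeq_of_readsL hk2 (6 - d) (by omega)
      rw [show k - ((6 - d : ℕ) : ℤ) = k - 6 + d by omega] at this
      rw [this, reflect]
      congr 1; omega
    · have := ih (d - 7) (by omega)
      have h2 := hper (k - 6 + (d - 7 : ℕ)) (by omega)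
      rw [show k - 6 + ((d - 7 : ℕ) : ℤ) + 7 = k - 6 + d by omega] at h2
      rw [h2, this, reflect, reflect, ← bSeq_add (-(k - 6 + d + (3 - k)))]
      congr 1; omega

/-- There is no point of the Lagrange spectrum between `bInf` and `BInf`. -/
lemma gap {x : ℝ} (hx : x ∈ lagrangeSpectrum) (h1 : bInf < x) : BInf ≤ x := by
  by_contra h2
  push Not at h2
  obtain ⟨α, hirr, hα⟩ := hx
  obtain ⟨S, hS, hexp⟩ := exists_expansion hirr
  have hb := lt_bInf
  have hB := BInf_lt
  -- `upper` and `lower` translate the value of the limsup into statements about `lam S`; `lower`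
  -- only treats c above b∞, so that c ≥ 2.
  have upper : ∀ c, x < c → ∃ N : ℤ, ∀ n, N ≤ n → lam S n < c := by
    intro c hc
    by_contra hcon
    push Not at hcon
    have : ∃ᶠ k : ℕ in atTop, c ≤ lam S k := by
      rw [frequently_atTop]
      intro a
      obtain ⟨n, hn, hn'⟩ := hcon a
      exact ⟨n.toNat, by omega, by rwa [show ((n.toNat : ℕ) : ℤ) = n by omega]⟩
    have := le_bestConstant hS hexp this
    rw [hα, EReal.coe_le_coe_iff] at this
    linarith
  have lower : ∀ c, bInf < c → c < x → ∃ᶠ k : ℕ in atTop, c < lam S k := by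
    intro c hc1 hc2 hcon
    have : ∀ᶠ k : ℕ in atTop, lam S k ≤ c := hcon.mono fun k hk => not_lt.1 hk
    have := bestConstant_le hS hexp (by linarith) this
    rw [hα, EReal.coe_le_coe_iff] at this
    linarith
  have hdig : ∀ᶠ k : ℕ in atTop, S k = 1 ∨ S k = 2 := by
    obtain ⟨N, hN⟩ := upper (7 / 2) (by linarith)
    exact eventually_atTop.2 ⟨(N + 1).toNat, fun k hk => eventually_dig hS hN k (by omega)⟩
  have adm : ∀ T, Dig T → (∀ i, lam T i ≤ x) → Adm T := fun T hT h =>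
    ⟨hT, fun i => (h i).trans_lt (by linarith)⟩
  have periodic : ∀ T, Dig T → (∀ i, lam T i ≤ bInf) → ∀ k s : ℤ,
      (∀ n, k ≤ n → S n = T (n + s)) → False := by
    intro T hT hTb k s h
    obtain ⟨K, hK⟩ := eventually_abs_lam_sub_lt hS hT.bpos h (half_pos (sub_pos.2 h1))
    obtain ⟨n, hn, hn'⟩ := frequently_atTop.1 (lower ((bInf + x) / 2) (by linarith)
      (by linarith)) K.toNat
    have e1 := (abs_lt.1 (hK n (by omega))).2
    have e2 := hTb (n + s)
    linarith
  -- If replication failed arbitrarily far out, a limit of shifts centred at the failures would be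
  -- admissible and contain www not followed by w. Then minimality would give it a value of `lam` at
  -- least B∞, although its values are at most x.
  have repR : ∃ N : ℤ, ∀ n, N ≤ n → ReadsR S n w3 → ReadsR S (n + 21) w := by
    by_contra hcon
    push Not at hcon
    have hP : ∃ᶠ k : ℕ in atTop, ReadsR S k w3 ∧ ¬ ReadsR S (k + 21) w := by
      rw [frequently_atTop]
      intro a
      obtain ⟨n, hn, hn'⟩ := hcon a
      exact ⟨n.toNat, by omega, by rwa [show ((n.toNat : ℕ) : ℤ) = n by omega]⟩
    obtain ⟨T, hT, hlim⟩ := exists_limit hdig hP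
    have hTx := lam_limit_le hS hT.bpos hlim upper
    obtain ⟨k, -, ⟨hk1, hk2⟩, hk3⟩ := hlim 40 0
    have r1 : ReadsR T 0 w3 := hk1.congr fun i hi => by
      have : i < 21 := hi
      rw [hk3 i (by rw [abs_of_nonneg] <;> push_cast <;> omega), zero_add]
    rcases (adm T hT hTx).replicate r1 with h | ⟨h, h'⟩
    · refine hk2 (h.congr fun i hi => ?_)
      have : i < 7 := hi
      rw [add_assoc, add_assoc, hk3 (21 + i) (by rw [abs_of_nonneg] <;> push_cast <;> omega), zero_add]
    · have := (adm T hT hTx).BInf_le h (by simpa using h')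
      linarith [hTx (0 - 7 + 17)]
  have repL : ∃ N : ℤ, ∀ n, N ≤ n → ReadsL S n w3 → ReadsL S (n - 21) w := by
    by_contra hcon
    push Not at hcon
    have hP : ∃ᶠ k : ℕ in atTop, ReadsL S k w3 ∧ ¬ ReadsL S (k - 21) w := by
      rw [frequently_atTop]
      intro a
      obtain ⟨n, hn, hn'⟩ := hcon a
      exact ⟨n.toNat, by omega, by rwa [show ((n.toNat : ℕ) : ℤ) = n by omega]⟩
    obtain ⟨T, hT, hlim⟩ := exists_limit hdig hP
    have hTx := lam_limit_le hS hT.bpos hlim upper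
    obtain ⟨k, -, ⟨hk1, hk2⟩, hk3⟩ := hlim 40 0
    have r1 : ReadsR (reflect T) 0 w3 := by
      rw [readsR_reflect, neg_zero, readsL_iff]
      intro i hi
      have : i < 21 := hi
      rw [← (readsL_iff _ _).1 hk1 i hi, sub_eq_add_neg, sub_eq_add_neg,
        hk3 (-i) (by rw [abs_of_nonpos] <;> push_cast <;> omega), zero_add]
    rcases (adm T hT hTx).reflect.replicate r1 with h | ⟨h, h'⟩
    · refine hk2 ?_
      rw [readsR_reflect] at h
      rw [readsL_iff]
      intro i hi
      have : i < 7 := hi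
      rw [← (readsL_iff _ _).1 h i hi, show (k : ℤ) - 21 - i = k + (-21 - i) by ring,
        hk3 (-21 - i) (by rw [abs_of_nonpos] <;> push_cast <;> omega)]
      congr 1
    · have := (adm T hT hTx).reflect.BInf_le h (by simpa using h')
      rw [lam_reflect hT.bpos] at this
      linarith [hTx (-(0 - 7 + 17))]
  -- Centring the shifts at values of `lam` above the midpoint of b∞ and x gives a limit to which
  -- local uniqueness applies at the origin.
  obtain ⟨T, hT, hlim⟩ := exists_limit hdig (lower ((bInf + x) / 2) (by linarith) (by linarith))
  have hTx := lam_limit_le hS hT.bpos hlim upper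
  have hT0 := le_lam_limit hS hT.bpos hlim
  rcases (adm T hT hTx).reads_w3 (n := 0) (by norm_num at hb ⊢; linarith) with h | h
  · obtain ⟨N, hN⟩ := repR
    obtain ⟨k, hk1, -, hk2⟩ := hlim 40 (N.natAbs + 10)
    have hr : ReadsR S (k - 10) w3 := h.congr fun i hi => by
      have : i < 21 := hi
      rw [show (k : ℤ) - 10 + i = k + (0 - 10 + i) by ring, hk2]
      rw [abs_le]; push_cast; constructor <;> omega
    exact periodic bSeq dig_bSeq lam_bSeq_le _ _
      (eq_bSeq_of_replicateR hN (by omega) hr)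
  · obtain ⟨N, hN⟩ := repL
    obtain ⟨k, s, hks⟩ := eq_bSeq_of_replicateL hN fun K => by
      obtain ⟨k, hk1, -, hk2⟩ := hlim 40 K.natAbs
      refine ⟨k + 10, by omega, ?_⟩
      rw [readsL_iff]
      intro i hi
      have : i < 21 := hi
      rw [← (readsL_iff _ _).1 h i hi, show (k : ℤ) + 10 - i = k + (0 + 10 - i) by ring, hk2]
      rw [abs_le]; push_cast; constructor <;> omega
    exact periodic (reflect bSeq) dig_bSeq.reflect
      (fun i => by rw [lam_reflect dig_bSeq.bpos]; exact lam_bSeq_le _) _ _ hks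

end MarkovLagrange

end

noncomputable section

namespace MarkovLagrange

/-! ### Points of the Lagrange spectrum -/

/-- The number [0, S₁, S₂, …] realizes c as soon as c is the limsup of `lam S n` for n → +∞. -/
lemma mem_lagrangeSpectrum {S : ℤ → ℕ} (hS : BPos S) {c : ℝ} (hc : 2 ≤ c)
    (hle : ∀ ε > 0, ∃ K : ℤ, ∀ n, K ≤ n → lam S n ≤ c + ε)
    (hge : ∀ ε > 0, ∀ K : ℤ, ∃ n, K ≤ n ∧ c - ε ≤ lam S n) : c ∈ lagrangeSpectrum := by
  have hα : 1 / fwd S 1 = (0 : ℤ) + 1 / fwd S 1 := by simp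
  refine ⟨1 / fwd S 1, irrational_expansion hS hα, le_antisymm ?_ ?_⟩
  · refine EReal.le_of_forall_lt_iff_le.1 fun z hz => ?_
    have hz' : c < z := EReal.coe_lt_coe_iff.1 hz
    obtain ⟨K, hK⟩ := hle (z - c) (by linarith)
    refine bestConstant_le hS hα (by linarith) (eventually_atTop.2 ⟨K.toNat, fun k hk => ?_⟩)
    have := hK k (by omega)
    linarith
  · refine EReal.ge_of_forall_gt_iff_ge.1 fun z hz => ?_
    have hz' : z < c := EReal.coe_lt_coe_iff.1 hz
    refine le_bestConstant hS hα (frequently_atTop.2 fun a => ?_)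
    obtain ⟨n, hn, hn'⟩ := hge (c - z) (by linarith) a
    exact ⟨n.toNat, by omega, by rw [show ((n.toNat : ℕ) : ℤ) = n by omega]; linarith⟩

lemma bInf_mem : bInf ∈ lagrangeSpectrum := by
  have := lt_bInf
  refine mem_lagrangeSpectrum dig_bSeq.bpos (by linarith) (fun ε hε => ⟨0, fun n _ => ?_⟩)
    fun ε hε K => ⟨0 + 7 * K.natAbs, by omega, ?_⟩
  · have := lam_bSeq_le n
    linarith
  · rw [lam_bSeq_add_mul, ← bInf_eq]
    linarith

/-! ### Gluing copies of the sequence of B∞. -/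

lemma BSeq_of_le {i : ℤ} (h : 11 ≤ i) :
    BSeq i = ([1, 1, 2, 1, 2, 2, 2, 1, 2, 1, 1, 2] : List ℕ).getD ((i - 11) % 12).toNat 0 := by
  have hl : (w ++ w ++ w ++ w).length = 28 := by decide
  rw [BSeq, biSeq, if_neg (by push_cast; omega), if_neg (by rw [hl]; push_cast; omega), hl]
  push_cast
  rw [show i + 17 - 28 = i - 11 by ring]
  rfl

lemma BSeq_of_lt {i : ℤ} (h : i < -17) :
    BSeq i = ([2, 1, 1, 2, 1, 1, 2, 1, 2, 2, 2, 1] : List ℕ).getD ((i + 17) % 12).toNat 0 := by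
  rw [BSeq, biSeq, if_pos (by push_cast; omega)]
  rfl

/-- The two periodic ends of `BSeq` match. -/
lemma BSeq_glue {i : ℤ} (m : ℤ) (h : 11 ≤ i) (h' : i - 12 * m < -17) :
    BSeq i = BSeq (i - 12 * m) := by
  rw [BSeq_of_le h, BSeq_of_lt h']
  have key : ∀ x ∈ Finset.Ico (0 : ℤ) 12,
      ([1, 1, 2, 1, 2, 2, 2, 1, 2, 1, 1, 2] : List ℕ).getD x.toNat 0 =
      ([2, 1, 1, 2, 1, 1, 2, 1, 2, 2, 2, 1] : List ℕ).getD ((x + 4) % 12).toNat 0 := by decide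
  have := key ((i - 11) % 12) (Finset.mem_Ico.2 ⟨by omega, by omega⟩)
  rw [this]
  congr 2
  omega

/-- Positions of the copies of `wwww` in the sequence realizing `BInf`. -/
def place (k : ℕ) : ℤ := 12 * k ^ 2 + 48 * k

lemma place_succ (k : ℕ) : place (k + 1) = place k + (24 * k + 60) := by
  simp only [place]; push_cast; ring

lemma place_strictMono : StrictMono place := strictMono_nat_of_lt_succ fun k => by
  rw [place_succ]; omega

lemma le_place (k : ℕ) : (k : ℤ) ≤ place k := by
  simp only [place]; nlinarith [sq_nonneg (k : ℤ)]

lemma exists_place (n : ℤ) (hn : -17 ≤ n) : ∃ k, place k - 17 ≤ n ∧ n < place (k + 1) - 17 := by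
  classical
  have h : ∃ k, n < place (k + 1) - 17 := ⟨(n + 17).toNat, by
    have := le_place ((n + 17).toNat + 1)
    push_cast at this
    omega⟩
  refine ⟨Nat.find h, ?_, Nat.find_spec h⟩
  cases hk : Nat.find h with
  | zero => simpa [place] using hn
  | succ k =>
    have := Nat.find_min h (m := k) (by omega)
    omega

/-- Copy number k runs from the start of its wwww, at `place k - 17`, to the start of the next one.
Consecutive distances are multiples of 12, so the copies join in phase, and they tend to infinity.
-/
lemma exists_glued : ∃ S : ℤ → ℕ, Dig S ∧ ∀ k n, place k - 17 ≤ n → n < place (k + 1) - 17 →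
    S n = BSeq (n - place k) := by
  classical
  refine ⟨fun n => if h : ∃ k, place k - 17 ≤ n ∧ n < place (k + 1) - 17 then
    BSeq (n - place h.choose) else 1, fun n => ?_, fun k n h1 h2 => ?_⟩
  · dsimp only
    split_ifs
    · exact dig_BSeq _
    · simp
  · have h : ∃ k, place k - 17 ≤ n ∧ n < place (k + 1) - 17 := ⟨k, h1, h2⟩
    dsimp only
    rw [dif_pos h]
    obtain ⟨h3, h4⟩ := h.choose_spec
    have e1 : h.choose < k + 1 := place_strictMono.lt_iff_lt.1 (by omega)
    have e2 : k < h.choose + 1 := place_strictMono.lt_iff_lt.1 (by omega)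
    rw [show h.choose = k by omega]

lemma BInf_mem : BInf ∈ lagrangeSpectrum := by
  obtain ⟨S, hS, hglue⟩ := exists_glued
  have hB := lt_BInf
  -- By `BSeq_glue`, the periodic tail of copy k is also the left end of copy k + 1, so S agrees
  -- with that copy from the end of the preceding wwww to the start of the following one.
  have wide : ∀ k n, place k + 11 ≤ n → n < place (k + 2) - 17 →
      S n = BSeq (n - place (k + 1)) := by
    intro k n h1 h2
    by_cases h : n < place (k + 1) - 17
    · rw [hglue k n (by omega) h, place_succ]
      have := BSeq_glue (i := n - place k) (2 * k + 5) (by omega) (by rw [place_succ] at h; omega)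
      rw [this]
      congr 1; ring
    · exact hglue (k + 1) n (by omega) h2
  have near : ∀ ε > 0, ∃ j : ℕ, ∀ (n : ℤ) (m : ℕ), place m + 11 + (2 * j + 1) ≤ n →
      n + (2 * j + 1) < place (m + 2) - 17 → |lam S n - lam BSeq (n - place (m + 1))| ≤ ε := by
    intro ε hε
    obtain ⟨j, hj⟩ := exists_pow_lt_of_lt_one (half_pos hε) (by norm_num : (1 / 4 : ℝ) < 1)
    refine ⟨j, fun n m h1 h2 => ?_⟩
    have := abs_lam_sub_le hS.bpos dig_BSeq.bpos n (n - place (m + 1)) j fun i hi => by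
      obtain ⟨h3, h4⟩ := abs_le.1 hi
      rw [wide m (n + i) (by omega) (by omega)]
      congr 1; ring
    linarith
  refine mem_lagrangeSpectrum hS.bpos (by linarith) (fun ε hε => ?_) fun ε hε K => ?_
  · obtain ⟨j, hj⟩ := near ε hε
    refine ⟨place (j + 1), fun n hn => ?_⟩
    have hn0 := le_place (j + 1)
    obtain ⟨k, hk1, hk2⟩ := exists_place n (by push_cast at hn0; omega)
    have hjk : j + 1 < k + 1 := place_strictMono.lt_iff_lt.1 (by omega)
    obtain ⟨k, rfl⟩ : ∃ k', k = k' + 1 := ⟨k - 1, by omega⟩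
    have e1 := place_succ k
    have e2 : place (k + 2) = place (k + 1) + (24 * (k + 1 : ℕ) + 60) := place_succ (k + 1)
    have e3 : place (k + 3) = place (k + 2) + (24 * (k + 2 : ℕ) + 60) := place_succ (k + 2)
    have hk2' : n < place (k + 2) - 17 := hk2
    push_cast at e2 e3
    -- Far enough from the start of the next wwww, the comparison is with the current copy;
    -- otherwise it is with the next one. The growing distances leave room for margins of 2 j + 1 in
    -- both cases.
    by_cases hmid : n + (2 * j + 1) < place (k + 2) - 17
    · have h1 := (abs_le.1 (hj n k (by omega) hmid)).2
      have h2 := lam_BSeq_le (n - place (k + 1))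
      linarith
    · have h1 := (abs_le.1 (hj n (k + 1) (by omega)
        (show n + (2 * j + 1) < place (k + 3) - 17 by omega))).2
      have h2 := lam_BSeq_le (n - place (k + 1 + 1))
      linarith
  · obtain ⟨j, hj⟩ := near ε hε
    set m := K.natAbs + j with hm
    have e1 := place_succ m
    have e2 : place (m + 2) = place (m + 1) + (24 * (m + 1 : ℕ) + 60) := place_succ (m + 1)
    push_cast at e2
    have h0 := le_place (m + 1)
    push_cast at h0
    refine ⟨place (m + 1), by omega, ?_⟩
    have h1 := (abs_le.1 (hj (place (m + 1)) m (by omega) (by omega))).1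
    rw [sub_self, ← BInf_eq] at h1
    linarith

lemma mOne_mem : mOne ∈ markovSpectrum := by
  have h := lt_mOne
  rw [mOne_eq] at h ⊢
  exact lam_mem_markovSpectrum dig_mSeq.bpos (by linarith) lam_mSeq_le

/-! ### Exact values -/

/-- The matrix `(p, q, r, s)` of the map `x ↦ [l, x] = (p x + q) / (r x + s)`. -/
def mobius : List ℕ → ℕ × ℕ × ℕ × ℕ
  | [] => (1, 0, 0, 1)
  | a :: l => match mobius l with
    | (p, q, r, s) => (a * p + r, a * q + s, p, q)

lemma fwd_mobius {T : ℤ → ℕ} (hT : BPos T) {n m : ℤ} {l : List ℕ} (hl : ReadsR T n l)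
    (hm : m = n + l.length) {p q r s : ℕ} (h : mobius l = (p, q, r, s)) :
    (r * fwd T m + s) * fwd T n = p * fwd T m + q := by
  induction l generalizing n p q r s with
  | nil =>
    simp only [mobius, Prod.mk.injEq] at h
    obtain ⟨rfl, rfl, rfl, rfl⟩ := h
    subst hm
    simp
  | cons a l ih =>
    rcases h' : mobius l with ⟨p', q', r', s'⟩
    simp only [mobius, h', Prod.mk.injEq] at h
    obtain ⟨rfl, rfl, rfl, rfl⟩ := h
    have e := ih hl.2 (by rw [hm, List.length_cons]; push_cast; ring) h'
    have h1 := one_lt_fwd hT (n + 1)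
    rw [fwd_eq hT n, hl.1]
    push_cast
    have h2 : fwd T (n + 1) ≠ 0 := by positivity
    field_simp
    linear_combination (-1 : ℝ) * e

lemma bwd_mobius {T : ℤ → ℕ} (hT : BPos T) {n m : ℤ} {l : List ℕ} (hl : ReadsL T n l)
    (hm : m = n - l.length) {p q r s : ℕ} (h : mobius l = (p, q, r, s)) :
    (r * bwd T m + s) * bwd T n = p * bwd T m + q := by
  have := fwd_mobius hT.reflect (n := -n) (m := -m) (l := l)
    (by rw [readsR_reflect, neg_neg]; exact hl) (by rw [hm]; ring) h
  rwa [fwd_reflect, fwd_reflect, neg_neg, neg_neg] at this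

lemma sqrt_eq_of_root {d x : ℝ} (h : x ^ 2 = d) (hx : 0 ≤ x) : √d = x := by
  rw [← h, Real.sqrt_sq hx]

/-- The purely periodic tail is fixed by the Möbius map of its period, hence is a root of a
quadratic equation. Completing the square expresses √151905 through that tail, and the preperiod
carries this to the value at 0. -/
lemma fwd_BSeq_zero : fwd BSeq 0 = 253 / 128 + √151905 / 640 := by
  have h1 := fwd_mobius dig_BSeq.bpos (readsR_factor (T := BSeq) 11 12) (m := 23)
    (by rw [length_factor]; norm_num) (p := 2547) (q := 988) (r := 1472) (s := 571)
    (by decide +kernel)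
  have h2 := fwd_mobius dig_BSeq.bpos (readsR_factor (T := BSeq) 0 11) (m := 11)
    (by rw [length_factor]; norm_num) (p := 1753) (q := 680) (r := 678) (s := 263)
    (by decide +kernel)
  have h3 : fwd BSeq 23 = fwd BSeq 11 := by
    refine congrArg cfValue (funext fun k => ?_)
    rw [← BSeq_add (11 + k) (by omega)]; exact congrArg BSeq (by ring)
  have h4 := one_lt_fwd dig_BSeq.bpos 11
  rw [h3] at h1
  push_cast at h1 h2
  have h5 := sqrt_eq_of_root (d := 151905) (x := 368 * fwd BSeq 11 - 247)
    (by linear_combination 92 * h1) (by linarith)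
  have h6 : (0 : ℝ) < 678 * fwd BSeq 11 + 263 := by linarith
  refine mul_left_cancel₀ h6.ne' ?_
  rw [h2, h5]
  linear_combination (-(678 * 368) / (640 * 1472) : ℝ) * h1

lemma bwd_BSeq_neg_one :
    1 / bwd BSeq (-1) = 107135063437 / 151428137171 + √151905 / 454284411513 := by
  have h1 := bwd_mobius dig_BSeq.bpos (n := -18) ((readsR_factor (T := BSeq) (-29) 12).reverse
    (by rw [length_factor]; norm_num)) (m := -30)
    (by rw [List.length_reverse, length_factor]; norm_num) (p := 2447) (q := 948) (r := 1732)
    (s := 671) (by decide +kernel)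
  have h2 := bwd_mobius dig_BSeq.bpos (n := -1) ((readsR_factor (T := BSeq) (-17) 17).reverse
    (by rw [length_factor]; norm_num)) (m := -18)
    (by rw [List.length_reverse, length_factor]; norm_num) (p := 127852) (q := 54003) (r := 90455)
    (s := 38207) (by decide +kernel)
  have h3 : bwd BSeq (-30) = bwd BSeq (-18) := by
    refine congrArg cfValue (funext fun k => ?_)
    rw [← BSeq_sub (-18 - k) (by omega)]; exact congrArg BSeq (by ring)
  have h4 := one_lt_bwd dig_BSeq.bpos (-18)
  have h4' := one_lt_bwd dig_BSeq.bpos (-1)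
  rw [h3] at h1
  push_cast at h1 h2
  have h5 := sqrt_eq_of_root (d := 151905) (x := 433 * bwd BSeq (-18) - 222)
    (by linear_combination (433 ^ 2 / 1732 : ℝ) * h1) (by linarith)
  have h6 : (0 : ℝ) < 90455 * bwd BSeq (-18) + 38207 := by linarith
  have h7 : (0 : ℝ) < 127852 * bwd BSeq (-18) + 54003 := by linarith
  have h8 : 1 / bwd BSeq (-1) =
      (90455 * bwd BSeq (-18) + 38207) / (127852 * bwd BSeq (-18) + 54003) := by
    rw [← h2]; field_simp
  rw [h8, h5, div_eq_iff h7.ne']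
  linear_combination (-(127852 * 433) / (454284411513 * 1732) : ℝ) * h1

lemma fwd_mSeq_zero : fwd mSeq 0 = 77 / 82 + √18229 / 82 := by
  have h1 := fwd_mobius dig_mSeq.bpos (readsR_factor (T := mSeq) 4 7) (m := 11)
    (by rw [length_factor]; norm_num) (p := 116) (q := 45) (r := 49) (s := 19)
    (by decide +kernel)
  have h2 := fwd_mobius dig_mSeq.bpos (readsR_factor (T := mSeq) 0 4) (m := 4)
    (by rw [length_factor]; norm_num) (p := 13) (q := 5) (r := 5) (s := 2)
    (by decide +kernel)
  have h3 : fwd mSeq 11 = fwd mSeq 4 := by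
    refine congrArg cfValue (funext fun k => ?_)
    rw [← mSeq_add (4 + k) (by omega)]; exact congrArg mSeq (by ring)
  have h4 := one_lt_fwd dig_mSeq.bpos 4
  rw [h3] at h1
  push_cast at h1 h2
  have h5 := sqrt_eq_of_root (d := 18229) (x := 98 * fwd mSeq 4 - 97)
    (by linear_combination 196 * h1) (by linarith)
  have h6 : (0 : ℝ) < 5 * fwd mSeq 4 + 2 := by linarith
  refine mul_left_cancel₀ h6.ne' ?_
  rw [h2, h5]
  linear_combination (-(5 * 98) / (82 * 49) : ℝ) * h1

lemma bwd_mSeq_neg_one : 1 / bwd mSeq (-1) = 31 / 57 + √87 / 57 := by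
  have h1 := bwd_mobius dig_mSeq.bpos (n := -11) ((readsR_factor (T := mSeq) (-16) 6).reverse
    (by rw [length_factor]; norm_num)) (m := -17)
    (by rw [List.length_reverse, length_factor]; norm_num) (p := 45) (q := 19) (r := 26)
    (s := 11) (by decide +kernel)
  have h2 := bwd_mobius dig_mSeq.bpos (n := -1) ((readsR_factor (T := mSeq) (-10) 10).reverse
    (by rw [length_factor]; norm_num)) (m := -11)
    (by rw [List.length_reverse, length_factor]; norm_num) (p := 947) (q := 400) (r := 670)
    (s := 283) (by decide +kernel)
  have h3 : bwd mSeq (-17) = bwd mSeq (-11) := by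
    refine congrArg cfValue (funext fun k => ?_)
    rw [← mSeq_sub (-11 - k) (by omega)]; exact congrArg mSeq (by ring)
  have h4 := one_lt_bwd dig_mSeq.bpos (-11)
  have h4' := one_lt_bwd dig_mSeq.bpos (-1)
  rw [h3] at h1
  push_cast at h1 h2
  have h5 := sqrt_eq_of_root (d := 87) (x := (26 * bwd mSeq (-11) - 17) / 3)
    (by linear_combination (26 / 9 : ℝ) * h1) (by linarith)
  have h6 : (0 : ℝ) < 670 * bwd mSeq (-11) + 283 := by linarith
  have h7 : (0 : ℝ) < 947 * bwd mSeq (-11) + 400 := by linarith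
  have h8 : 1 / bwd mSeq (-1) =
      (670 * bwd mSeq (-11) + 283) / (947 * bwd mSeq (-11) + 400) := by
    rw [← h2]; field_simp
  rw [h8, h5, div_eq_iff h7.ne']
  linear_combination (-947 / (57 * 3) : ℝ) * h1

lemma BInf_sub_mOne : BInf - mOne = deltaZero := by
  rw [BInf_eq, mOne_eq, lam, lam, zero_sub, fwd_BSeq_zero, bwd_BSeq_neg_one, fwd_mSeq_zero,
    bwd_mSeq_neg_one, deltaZero]
  ring

lemma abs_deltaZero_sub_lt : |deltaZero - 9.1094243388e-8| < 1e-18 := by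
  have a1 : (9.327379053088815045 : ℝ) < √87 := Real.lt_sqrt_of_sq_lt (by norm_num)
  have a2 : √87 < (9.327379053088815046 : ℝ) :=
    (Real.sqrt_lt' (by norm_num)).2 (by norm_num)
  have b1 : (135.014814002019793176 : ℝ) < √18229 := Real.lt_sqrt_of_sq_lt (by norm_num)
  have b2 : √18229 < (135.014814002019793177 : ℝ) :=
    (Real.sqrt_lt' (by norm_num)).2 (by norm_num)
  have c1 : (389.749919820389443527 : ℝ) < √151905 := Real.lt_sqrt_of_sq_lt (by norm_num)
  have c2 : √151905 < (389.749919820389443528 : ℝ) :=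
    (Real.sqrt_lt' (by norm_num)).2 (by norm_num)
  rw [deltaZero, abs_lt, lt_sub_iff_add_lt, sub_lt_iff_lt_add, lt_div_iff₀ (by norm_num),
    div_lt_iff₀ (by norm_num)]
  constructor
  · norm_num at *; linarith
  · norm_num at *; linarith

end MarkovLagrange

end

/-! ### Assembly: the distance from m₁ to L and the Hausdorff bound. -/

theorem mainTheorem2 :
    -- the lower bound for the (a priori extended real valued) Hausdorff distance
    ENNReal.ofReal MarkovLagrange.deltaZero ≤
        Metric.hausdorffEDist MarkovLagrange.markovSpectrum MarkovLagrange.lagrangeSpectrum ∧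
    |MarkovLagrange.deltaZero - 9.1094243388e-8| < 1e-18 ∧
    -- `(b_∞, B_∞)` is a gap of `L` (a bounded component of its complement) near 3.293
    |MarkovLagrange.bInf - 3.2930442439| < 1e-10 ∧
    MarkovLagrange.bInf < MarkovLagrange.BInf ∧
    MarkovLagrange.bInf ∈ MarkovLagrange.lagrangeSpectrum ∧
    MarkovLagrange.BInf ∈ MarkovLagrange.lagrangeSpectrum ∧
    Disjoint (Set.Ioo MarkovLagrange.bInf MarkovLagrange.BInf) MarkovLagrange.lagrangeSpectrum ∧
    -- `m₁` is a point of `M` in this gap, at distance exactly `B_∞ - m₁ = δ₀` from `L`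
    MarkovLagrange.mOne ∈ MarkovLagrange.markovSpectrum ∧
    MarkovLagrange.mOne ∈ Set.Ioo MarkovLagrange.bInf MarkovLagrange.BInf ∧
    Metric.infDist MarkovLagrange.mOne MarkovLagrange.lagrangeSpectrum =
      MarkovLagrange.BInf - MarkovLagrange.mOne ∧
    MarkovLagrange.BInf - MarkovLagrange.mOne = MarkovLagrange.deltaZero := by
  open MarkovLagrange in
  have hb1 := lt_bInf
  have hb2 := bInf_lt
  have hB1 := lt_BInf
  have hB2 := BInf_lt
  have hm1 := lt_mOne
  have hm2 := mOne_lt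
  have hδ := BInf_sub_mOne
  have hlt : bInf < BInf := by linarith
  have hdist : ∀ y ∈ lagrangeSpectrum, BInf - mOne ≤ dist mOne y := by
    intro y hy
    rw [Real.dist_eq]
    -- The enclosures give m₁ − b∞ > 1.4 × 10⁻⁷, more than B∞ − m₁, which is below 9.2 × 10⁻⁸; so
    -- the upper end of the gap is the nearer one.
    rcases le_or_gt y bInf with h | h
    · exact le_trans (by linarith) (le_abs_self _)
    · have := gap hy h
      rw [abs_sub_comm]
      exact le_trans (by linarith) (le_abs_self _)
  have hne : lagrangeSpectrum.Nonempty := ⟨_, bInf_mem⟩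
  have hinf : Metric.infDist mOne lagrangeSpectrum = BInf - mOne := by
    apply le_antisymm
    · refine (Metric.infDist_le_dist_of_mem BInf_mem).trans ?_
      rw [Real.dist_eq, abs_sub_comm, abs_of_pos (by linarith)]
    · exact (Metric.le_infDist hne).2 fun {y} hy => hdist y hy
  refine ⟨?_, abs_deltaZero_sub_lt, ?_, hlt, bInf_mem, BInf_mem, ?_, mOne_mem,
    ⟨by linarith, by linarith⟩, hinf, hδ⟩
  · rw [← hδ, ← hinf, Metric.infDist, ENNReal.ofReal_toReal (Metric.infEDist_ne_top hne)]
    exact Metric.infEDist_le_hausdorffEDist_of_mem mOne_mem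
  · rw [abs_lt]
    constructor <;> norm_num at hb1 hb2 ⊢ <;> linarith
  · rw [Set.disjoint_left]
    intro y hy hyL
    exact absurd (gap hyL hy.1) (not_le.2 hy.2)
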